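/- Let $\delta_1<\delta_2$ be real numbers, let $\mathcal Y\subset(\delta_1,\delta_2)$ be a set of $m\ge 1$ distinct points $y_{(1)}<\dots<y_{(m)}$, put $y_{(0)}=\delta_1$, $y_{(m+1)}=\delta_2$, $I_i=(y_{(i-1)},y_{(i)})$ for $1\le i\le m+1$, and let $c\in(0,1)$. For a point $x$ of a middle interval $I_i$ ($2\le i\le m$), with $a=y_{(i-1)}$ and $b=y_{(i)}$, let $$N(x)=\begin{cases}\left(a,\ x+\frac{(1-c)(x-a)}{c}\right)\cap(a,b)& \text{if } a<x\le a+c(b-a),\\[2pt] \left(x-\frac{c(b-x)}{1-c},\ b\right)\cap(a,b)&\text{if } a+c(b-a)<x<b;\end{cases}$$ for $x<y_{(1)}$ let $N(x)=(2x-y_{(1)},\,y_{(1)})$; for $x>y_{(m)}$ let $N(x)=(y_{(m)},\,2x-y_{(m)})$; and let $N(x)=\{x\}$ for $x\in\mathcal Y$. (This is the central similarity proximity region with expansion parameter $\tau=1$ and centrality parameter $c$.) Let $X_1,X_2,\dots$ be independent random variables, uniformly distributed on $(\delta_1,\delta_2)$. For $n\ge 1$ consider the digraph with vertices $X_1,\dots,X_n$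 and an arc from $X_j$ to $X_k$ ($j\ne k$) if and only if $X_k\in N(X_j)$. Let $D_{[i]}(1,c)$ be its subdigraph induced by those of $X_1,\dots,X_n$ that lie in $I_i$, let $n_i$ be the (random) number of its vertices, and let $\rho_{[i]}(1,c)$ be its relative density, i.e. the number of its arcs divided by $n_i(n_i-1)$, with $\rho_{[i]}(1,c)=0$ if $n_i\le 1$. Let $h_{jk}$ be half the number of arcs between $X_j$ and $X_k$. Let $i\in\{1,m+1\}$, i.e. let $I_i$ be an end interval. Then, with $$\mu_e(1)=P\bigl(X_2\in N(X_1)\mid X_1,X_2\in I_i\bigr),\qquad \nu_e(1)=\operatorname{Cov}\bigl(h_{12},h_{13}\mid X_1,X_2,X_3\in I_i\bigr),$$ we have $\mu_e(1)=\tfrac34$, $4\,\nu_e(1)=\tfrac1{24}$, and, as $n_i\to\infty$, $$\sqrt{n_i}\,\bigl(\rho_{[i]}(1,c)-\tfrac34\bigr)\ \xrightarrow{\ \mathcal L\ }\ \mathcal N\bigl(0,\tfrac1{24}\bigr)$$ in both of the following senses. (a) Conditionally on $n_i=k$: for every $t\in\mathbb R$, the conditional probability $P\bigl(\sqrt{k}\,(\rho_{[i]}(1,c)-\tfrac34)\le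 t\mid n_i=k\bigr)$ converges, as $k\to\infty$, uniformly in $n\ge k$, to the value at $t$ of the distribution function of $\mathcal N(0,\tfrac1{24})$. (b) Unconditionally: $\sqrt{n_i}\,(\rho_{[i]}(1,c)-\tfrac34)$ converges in distribution to $\mathcal N(0,\tfrac1{24})$ as $n\to\infty$. -/

import Mathlib

open MeasureTheory ProbabilityTheory Filter Topology

/-- The order statistics `y_(1) < ... < y_(m)` of the `m`-point set `Y`, completed by
`y_(0) = δ₁` and `y_(m+1) = δ₂` (the value is `δ₂` for every index above `m`). -/
noncomputable def orderStat (Y : Finset ℝ) (δ₁ δ₂ : ℝ) (i : ℕ) : ℝ :=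
  if i = 0 then δ₁
  else if h : i - 1 < Y.card then Y.orderEmbOfFin rfl ⟨i - 1, h⟩
  else δ₂

/-- The interval `I_i = (y_(i-1), y_(i))`, for `i = 1, ..., m + 1`. The end intervals are
`i = 1` and `i = m + 1`. -/
noncomputable def cellInterval (Y : Finset ℝ) (δ₁ δ₂ : ℝ) (i : ℕ) : Set ℝ :=
  Set.Ioo (orderStat Y δ₁ δ₂ (i - 1)) (orderStat Y δ₁ δ₂ i)

/-- The central similarity proximity region `N(x, τ, c)` of a point `x` of a middle interval
`(a, b)`; at the centre `M_c = a + c (b - a)`, where either formula may be chosen, it is given by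
the first one. -/
noncomputable def middleRegion (a b τ c x : ℝ) : Set ℝ :=
  if x ≤ a + c * (b - a) then
    Set.Ioo (x - τ * (x - a)) (x + τ * (1 - c) * (x - a) / c) ∩ Set.Ioo a b
  else
    Set.Ioo (x - c * τ * (b - x) / (1 - c)) (x + τ * (b - x)) ∩ Set.Ioo a b

/-- The region `N_e(x, τ)` of a point `x` of the left end interval `(-∞, b)`, `b = y_(1)`.
Intersecting with `(-∞, b)` matters only for `τ > 1`. -/
def leftEndRegion (b τ x : ℝ) : Set ℝ :=
  Set.Ioo (x - τ * (b - x)) (x + τ * (b - x)) ∩ Set.Iio b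

/-- The region `N_e(x, τ)` of a point `x` of the right end interval `(a, ∞)`, `a = y_(m)`.
Intersecting with `(a, ∞)` matters only for `τ > 1`. -/
def rightEndRegion (a τ x : ℝ) : Set ℝ :=
  Set.Ioo (x - τ * (x - a)) (x + τ * (x - a)) ∩ Set.Ioi a

open Classical in
/-- The central similarity proximity region of `x ∈ ℝ` with respect to `Y`, with expansion
parameter `τ` and centrality parameter `c`. The end points of the interval of `ℝ \ Y` that holds
`x` are the largest point of `Y` below `x` and the smallest one above `x`, where they exist; `x` is
in an end interval if one of them does not. (The last value is for the empty `Y` only.) -/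
noncomputable def proximityRegion (Y : Finset ℝ) (τ c x : ℝ) : Set ℝ :=
  if x ∈ Y then {x}
  else if hl : (Y.filter (fun y => y < x)).Nonempty then
    if hr : (Y.filter (fun y => x < y)).Nonempty then
      middleRegion ((Y.filter (fun y => y < x)).max' hl) ((Y.filter (fun y => x < y)).min' hr) τ c x
    else rightEndRegion ((Y.filter (fun y => y < x)).max' hl) τ x
  else
    if hr : (Y.filter (fun y => x < y)).Nonempty then
      leftEndRegion ((Y.filter (fun y => x < y)).min' hr) τ x
    else Set.univ

/-- The central similarity proximity catch digraph (without loops) whose vertices are the points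
`x j`, `j ∈ V`: there is an arc from `x j` to `x k` iff `x k` lies in the proximity region
of `x j`. -/
def centralSimilarityPCD (Y : Finset ℝ) (τ c : ℝ) {V : Type*} (x : V → ℝ) : Digraph V where
  Adj j k := j ≠ k ∧ x k ∈ proximityRegion Y τ c (x j)

/-- The relative density of the subdigraph of `D` induced by the set `S` of vertices: the number of
its arcs divided by `|S| (|S| - 1)`. It is `0 / 0 = 0` for `|S| ≤ 1`, as it should be. -/
noncomputable def inducedRelDensity {V : Type*} (D : Digraph V) (S : Set V) : ℝ :=
  (Set.ncard {p : V × V | p.1 ∈ S ∧ p.2 ∈ S ∧ D.Adj p.1 p.2} : ℝ) /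
    ((S.ncard : ℝ) * ((S.ncard : ℝ) - 1))

/-- `n_i`: the number of the first `n` sample points that fall in the interval `I_i`. -/
noncomputable def cellCount (Y : Finset ℝ) (δ₁ δ₂ : ℝ) (i n : ℕ) (x : ℕ → ℝ) : ℕ :=
  Set.ncard {j : Fin n | x j ∈ cellInterval Y δ₁ δ₂ i}

/-- `ρ_[i](τ, c)`: the relative density of the subdigraph `D_[i](τ, c)`, which is induced, in the
digraph on the first `n` sample points, by the points that fall in the interval `I_i`. -/
noncomputable def cellRelDensity (Y : Finset ℝ) (δ₁ δ₂ τ c : ℝ) (i n : ℕ) (x : ℕ → ℝ) : ℝ :=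
  inducedRelDensity (centralSimilarityPCD Y τ c (fun j : Fin n => x j))
    {j : Fin n | x j ∈ cellInterval Y δ₁ δ₂ i}

open Classical in
/-- `h_jk`: half the number of arcs between the vertices `j` and `k`. -/
noncomputable def halfArcs {V : Type*} (D : Digraph V) (j k : V) : ℝ :=
  ((if D.Adj j k then 1 else 0) + (if D.Adj k j then 1 else 0)) / 2

open scoped ENNReal

/-! Replace a point of the end interval by its distance to the endpoint in `Y`, divided by the
length of the interval. The interval becomes `(0, 1)`, and at `τ = 1` there is an arc from `s` to
`t` exactly when `t < 2 * s` (`exists_endCoordinate`). Hence neither `c`, nor the length, nor the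
side matters. Given which sample points fall in the interval, these points are independent and
uniform there.

For `k ≥ 2` independent uniform points the centred relative density is a `U`-statistic of order two
with the bounded symmetric kernel `arcKernel`. An out-arc from `s` has probability `min (2 * s) 1`,
an in-arc `1 - s / 2`, so the projection is `g(s) = min (2 * s) 1 / 2 - s / 4 - 1 / 4`, with mean
`0` and second moment `1 / 96`. By Hoeffding's decomposition the statistic, scaled by `√k`, is `k ^
(-1/2)` times the sum of the `2 * g`, up to an error whose second moment is `O(1 / k)`; the
classical central limit theorem gives variance `4 / 96 = 1 / 24` (`tendstoInDistribution_uStat`,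
`tendsto_arcLaw`).

Given `n_i = k`, the law of the statistic is exactly `arcLaw k`, whatever `n` is; this yields (a)
with its uniformity. Unconditionally the law is a binomial mixture of the `arcLaw k`, in which every
fixed `k` has vanishing weight; this yields (b). -/

/-! ### Integrating out one independent variable -/

lemma measurable_comp_uncurry {α : Type*} [MeasurableSpace α] {φ : ℝ → ℝ → ℝ}
    (hφ : Measurable (Function.uncurry φ)) {f g : α → ℝ} (hf : Measurable f) (hg : Measurable g) :
    Measurable fun a => φ (f a) (g a) :=
  hφ.comp (hf.prodMk hg)

/-- Fubini for independent variables: if `F (·, y)` has mean zero under the law of `X` for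
every `y`, then `F (X, Y)` has mean zero. -/
lemma integral_comp_eq_zero_of_indepFun {Ω α β : Type*} [MeasurableSpace Ω] [MeasurableSpace α]
    [MeasurableSpace β] {P : Measure Ω} [IsProbabilityMeasure P] {X : Ω → α} {Y : Ω → β}
    (hXY : IndepFun X Y P) (hX : Measurable X) (hY : Measurable Y) {F : α → β → ℝ}
    (hF : Measurable (Function.uncurry F)) {C : ℝ} (hC : ∀ x y, |F x y| ≤ C)
    (h0 : ∀ y, ∫ x, F x y ∂(P.map X) = 0) :
    ∫ ω, F (X ω) (Y ω) ∂P = 0 := by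
  have := Measure.isProbabilityMeasure_map (μ := P) hX.aemeasurable
  have := Measure.isProbabilityMeasure_map (μ := P) hY.aemeasurable
  have h1 : ∫ ω, F (X ω) (Y ω) ∂P
      = ∫ z, Function.uncurry F z ∂(P.map (fun ω => (X ω, Y ω))) := by
    rw [integral_map (by fun_prop) hF.aestronglyMeasurable]
    rfl
  rw [h1, (indepFun_iff_map_prod_eq_prod_map_map hX.aemeasurable hY.aemeasurable).1 hXY,
    integral_prod_symm]
  · simp [Function.uncurry, h0]
  · exact Integrable.of_bound hF.aestronglyMeasurable C (ae_of_all _ fun z => hC z.1 z.2)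

/-- Only `j` must be fresh. The other variables enter as one tuple, which is independent of `V j`,
so `F` may use them with repetitions. -/
lemma integral_comp_eq_zero_of_iIndepFun {Ω ι : Type*} [MeasurableSpace Ω] [DecidableEq ι]
    {P : Measure Ω} [IsProbabilityMeasure P] {V : ι → Ω → ℝ} (hV : iIndepFun V P)
    (hVm : ∀ i, Measurable (V i)) {j : ι} {T : Finset ι} (hj : j ∉ T)
    {F : ℝ → (T → ℝ) → ℝ} (hF : Measurable (Function.uncurry F)) {C : ℝ}
    (hC : ∀ x y, |F x y| ≤ C) (h0 : ∀ y, ∫ x, F x y ∂(P.map (V j)) = 0) :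
    ∫ ω, F (V j ω) (fun i => V i ω) ∂P = 0 := by
  have hm : Measurable fun y : ({j} : Finset ι) → ℝ => y ⟨j, Finset.mem_singleton_self j⟩ :=
    measurable_pi_apply _
  have h := (hV.indepFun_finset {j} T (by simpa using hj) hVm).comp
    (φ := fun y : ({j} : Finset ι) → ℝ => y ⟨j, Finset.mem_singleton_self j⟩) (ψ := id)
    hm measurable_id
  exact integral_comp_eq_zero_of_indepFun (X := V j) (Y := fun ω (i : T) => V i ω) h (hVm j)
    (by fun_prop) hF hC h0

/-! ### Hoeffding decomposition of a kernel -/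

/-- The first-order projection of a kernel. -/
noncomputable def kernelProj (ν : Measure ℝ) (h : ℝ → ℝ → ℝ) (s : ℝ) : ℝ := ∫ t, h s t ∂ν

/-- The degenerate part of a kernel in its Hoeffding decomposition. -/
noncomputable def kernelDegen (ν : Measure ℝ) (h : ℝ → ℝ → ℝ) (s t : ℝ) : ℝ :=
  h s t - kernelProj ν h s - kernelProj ν h t

/-- A bounded measurable symmetric kernel with mean zero. -/
structure IsCenteredKernel (ν : Measure ℝ) (h : ℝ → ℝ → ℝ) (C : ℝ) : Prop where
  measurable : Measurable (Function.uncurry h)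
  symm : ∀ s t, h s t = h t s
  bound : ∀ s t, |h s t| ≤ C
  mean : ∫ s, kernelProj ν h s ∂ν = 0

namespace IsCenteredKernel

variable {ν : Measure ℝ} [IsProbabilityMeasure ν] {h : ℝ → ℝ → ℝ} {C : ℝ}

lemma measurable_proj (H : IsCenteredKernel ν h C) : Measurable (kernelProj ν h) :=
  (H.measurable.stronglyMeasurable.integral_prod_right' (ν := ν)).measurable

lemma bound_proj (H : IsCenteredKernel ν h C) (s : ℝ) : |kernelProj ν h s| ≤ C := by
  simpa [kernelProj] using
    norm_integral_le_of_norm_le_const (μ := ν) (f := h s) (ae_of_all _ (H.bound s))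

lemma measurable_degen (H : IsCenteredKernel ν h C) :
    Measurable (Function.uncurry (kernelDegen ν h)) :=
  (H.measurable.sub (H.measurable_proj.comp measurable_fst)).sub
    (H.measurable_proj.comp measurable_snd)

lemma bound_degen (H : IsCenteredKernel ν h C) (s t : ℝ) : |kernelDegen ν h s t| ≤ 3 * C := by
  have h1 := abs_le.1 (H.bound s t)
  have h2 := abs_le.1 (H.bound_proj s)
  have h3 := abs_le.1 (H.bound_proj t)
  rw [kernelDegen, abs_le]
  constructor <;> linarith

omit [IsProbabilityMeasure ν] in
lemma symm_degen (H : IsCenteredKernel ν h C) (s t : ℝ) :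
    kernelDegen ν h s t = kernelDegen ν h t s := by
  rw [kernelDegen, kernelDegen, H.symm s t]
  ring

lemma integrable_proj (H : IsCenteredKernel ν h C) : Integrable (kernelProj ν h) ν :=
  Integrable.of_bound H.measurable_proj.aestronglyMeasurable C (ae_of_all _ H.bound_proj)

lemma integrable_right (H : IsCenteredKernel ν h C) (s : ℝ) : Integrable (h s) ν :=
  Integrable.of_bound (H.measurable.comp (measurable_prodMk_left)).aestronglyMeasurable C
    (ae_of_all _ (H.bound s))

lemma integral_degen (H : IsCenteredKernel ν h C) (s : ℝ) :
    ∫ t, kernelDegen ν h s t ∂ν = 0 := by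
  simp only [kernelDegen]
  have h1 : Integrable (fun t => h s t - kernelProj ν h s) ν :=
    (H.integrable_right s).sub (integrable_const _)
  rw [integral_sub h1 H.integrable_proj, integral_sub (H.integrable_right s) (integrable_const _),
    H.mean]
  simp [kernelProj]

lemma integral_degen_left (H : IsCenteredKernel ν h C) (t : ℝ) :
    ∫ s, kernelDegen ν h s t ∂ν = 0 := by
  simpa [H.symm_degen] using H.integral_degen t

variable {Ω ι : Type*} [MeasurableSpace Ω] [DecidableEq ι] {P : Measure Ω}
  [IsProbabilityMeasure P] {V : ι → Ω → ℝ}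

/-- The variable with index `j` occurs once, and integrating it out kills the first factor while the
second stays fixed. Coincidences among `k`, `l`, `m` do no harm. -/
lemma integral_degen_mul_degen (H : IsCenteredKernel ν h C) (hV : iIndepFun V P)
    (hVm : ∀ i, Measurable (V i)) (hVν : ∀ i, P.map (V i) = ν) {j k l m : ι} (hk : j ≠ k)
    (hl : j ≠ l) (hm : j ≠ m) :
    ∫ ω, kernelDegen ν h (V j ω) (V k ω) * kernelDegen ν h (V l ω) (V m ω) ∂P = 0 := by
  have hb := H.bound_degen
  refine integral_comp_eq_zero_of_iIndepFun hV hVm (j := j) (T := {k, l, m}) (by simp [hk, hl, hm])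
    (F := fun x y => kernelDegen ν h x (y ⟨k, by simp⟩) *
      kernelDegen ν h (y ⟨l, by simp⟩) (y ⟨m, by simp⟩)) (C := (3 * C) * (3 * C)) ?_ ?_ ?_
  · exact (measurable_comp_uncurry H.measurable_degen (by fun_prop) (by fun_prop)).mul
      (measurable_comp_uncurry H.measurable_degen (by fun_prop) (by fun_prop))
  · intro x y
    rw [abs_mul]
    exact mul_le_mul (hb _ _) (hb _ _) (abs_nonneg _) ((abs_nonneg _).trans (hb 0 0))
  · intro y
    rw [integral_mul_const, hVν, H.integral_degen_left, zero_mul]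

/-- Distinct degenerate terms are orthogonal, unless they come from the same pair of indices. -/
lemma integral_degen_mul_degen_eq_zero (H : IsCenteredKernel ν h C) (hV : iIndepFun V P)
    (hVm : ∀ i, Measurable (V i)) (hVν : ∀ i, P.map (V i) = ν) {p q : ι × ι}
    (hp : p.1 ≠ p.2) (hpq : q ≠ p) (hpq' : q ≠ p.swap) :
    ∫ ω, kernelDegen ν h (V p.1 ω) (V p.2 ω) * kernelDegen ν h (V q.1 ω) (V q.2 ω) ∂P = 0 := by
  obtain ⟨j, k⟩ := p
  obtain ⟨l, m⟩ := q
  simp only [ne_eq, Prod.mk.injEq, Prod.swap_prod_mk] at *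
  by_cases h1 : j ≠ l ∧ j ≠ m
  · exact H.integral_degen_mul_degen hV hVm hVν hp h1.1 h1.2
  -- Here `j` is one of `l`, `m`. If `k` were one of them too, then `q` would be `p` or its swap; so
  -- `k` is the fresh index, and symmetry moves it to the first place.
  · have h2 : k ≠ l ∧ k ≠ m := by
      constructor <;> rintro rfl <;> grind
    simp only [H.symm_degen (V j _) (V k _)]
    exact H.integral_degen_mul_degen hV hVm hVν (Ne.symm hp) h2.1 h2.2

omit [DecidableEq ι] [IsProbabilityMeasure P] in
lemma measurable_degen_comp (H : IsCenteredKernel ν h C) (hVm : ∀ i, Measurable (V i)) (j k : ι) :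
    Measurable fun ω => kernelDegen ν h (V j ω) (V k ω) :=
  H.measurable_degen.comp ((hVm j).prodMk (hVm k))

/-- Expanding the square, a pair `p` contributes only against itself and its swap, by orthogonality;
each of these products is at most `(3 * C) ^ 2`. The second moment thus grows like the number of
pairs and not like its square. -/
lemma integral_sq_sum_degen_le (H : IsCenteredKernel ν h C) (hV : iIndepFun V P)
    (hVm : ∀ i, Measurable (V i)) (hVν : ∀ i, P.map (V i) = ν) (s : Finset ι) :
    ∫ ω, (∑ p ∈ s.offDiag, kernelDegen ν h (V p.1 ω) (V p.2 ω)) ^ 2 ∂P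
      ≤ s.offDiag.card * (2 * (3 * C) ^ 2) := by
  have hb := H.bound_degen
  have hbb : ∀ (p q : ι × ι) (ω : Ω), |kernelDegen ν h (V p.1 ω) (V p.2 ω) *
      kernelDegen ν h (V q.1 ω) (V q.2 ω)| ≤ (3 * C) ^ 2 := by
    intro p q ω
    rw [abs_mul, sq]
    exact mul_le_mul (hb _ _) (hb _ _) (abs_nonneg _) ((abs_nonneg _).trans (hb 0 0))
  have hi : ∀ p q : ι × ι, Integrable (fun ω => kernelDegen ν h (V p.1 ω) (V p.2 ω) *
      kernelDegen ν h (V q.1 ω) (V q.2 ω)) P := fun p q =>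
    Integrable.of_bound ((H.measurable_degen_comp hVm _ _).mul
      (H.measurable_degen_comp hVm _ _)).aestronglyMeasurable ((3 * C) ^ 2)
      (ae_of_all _ (hbb p q))
  simp only [sq (Finset.sum _ _), Finset.sum_mul_sum]
  rw [integral_finsetSum _ fun p _ => integrable_finsetSum _ fun q _ => hi p q,
    ← nsmul_eq_mul]
  refine Finset.sum_le_card_nsmul _ _ _ fun p hp => ?_
  rw [integral_finsetSum _ fun q _ => hi p q]
  have hp' : p.1 ≠ p.2 := (Finset.mem_offDiag.1 hp).2.2
  calc ∑ q ∈ s.offDiag, ∫ ω, kernelDegen ν h (V p.1 ω) (V p.2 ω) *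
          kernelDegen ν h (V q.1 ω) (V q.2 ω) ∂P
      ≤ ∑ q ∈ s.offDiag, if q ∈ ({p, p.swap} : Finset (ι × ι)) then (3 * C) ^ 2 else 0 := by
        refine Finset.sum_le_sum fun q _ => ?_
        split_ifs with hq
        · refine (le_abs_self _).trans ?_
          simpa using norm_integral_le_of_norm_le_const (μ := P) (f := fun ω =>
            kernelDegen ν h (V p.1 ω) (V p.2 ω) * kernelDegen ν h (V q.1 ω) (V q.2 ω))
            (ae_of_all _ (hbb p q))
        · simp only [Finset.mem_insert, Finset.mem_singleton, not_or] at hq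
          exact (H.integral_degen_mul_degen_eq_zero hV hVm hVν hp' hq.1 hq.2).le
    _ ≤ 2 * (3 * C) ^ 2 := by
        rw [← Finset.sum_filter, Finset.sum_const, nsmul_eq_mul]
        have : ((s.offDiag.filter (· ∈ ({p, p.swap} : Finset (ι × ι)))).card : ℝ) ≤ 2 := by
          have h1 : (s.offDiag.filter (· ∈ ({p, p.swap} : Finset (ι × ι)))).card ≤ 2 :=
            (Finset.card_le_card fun q hq => (Finset.mem_filter.1 hq).2).trans Finset.card_le_two
          exact_mod_cast h1
        gcongr

/-- The first-order projection is the conditional expectation of a kernel term given one of its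
variables and any third one. -/
lemma integral_sub_proj_mul (H : IsCenteredKernel ν h C) (hV : iIndepFun V P)
    (hVm : ∀ i, Measurable (V i)) (hVν : ∀ i, P.map (V i) = ν) {i j k : ι} (hij : i ≠ j)
    (hjk : j ≠ k) {φ : ℝ → ℝ → ℝ} (hφ : Measurable (Function.uncurry φ)) {D : ℝ}
    (hD : ∀ s t, |φ s t| ≤ D) :
    ∫ ω, (h (V i ω) (V j ω) - kernelProj ν h (V i ω)) * φ (V i ω) (V k ω) ∂P = 0 := by
  have hp := H.measurable_proj
  refine integral_comp_eq_zero_of_iIndepFun hV hVm (j := j) (T := {i, k})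
    (by simp [hij.symm, hjk])
    (F := fun x y => (h (y ⟨i, by simp⟩) x - kernelProj ν h (y ⟨i, by simp⟩)) *
      φ (y ⟨i, by simp⟩) (y ⟨k, by simp⟩)) (C := (2 * C) * D) ?_ ?_ ?_
  · exact ((measurable_comp_uncurry H.measurable (by fun_prop) (by fun_prop)).sub
      (hp.comp (by fun_prop))).mul (measurable_comp_uncurry hφ (by fun_prop) (by fun_prop))
  · intro x y
    have h1 := H.bound (y ⟨i, by simp⟩) x
    have h2 := H.bound_proj (y ⟨i, by simp⟩)
    rw [abs_mul]
    refine mul_le_mul ((abs_sub _ _).trans (by linarith)) (hD _ _) (abs_nonneg _) ?_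
    linarith [abs_nonneg (h (y ⟨i, by simp⟩) x)]
  · intro y
    rw [integral_mul_const, hVν, integral_sub (H.integrable_right _) (integrable_const _)]
    simp [kernelProj]

/-- The covariance of two kernel terms that share one index. -/
lemma covariance_eq (H : IsCenteredKernel ν h C) (hV : iIndepFun V P)
    (hVm : ∀ i, Measurable (V i)) (hVν : ∀ i, P.map (V i) = ν) {i j k : ι} (hij : i ≠ j)
    (hik : i ≠ k) (hjk : j ≠ k) :
    cov[fun ω => h (V i ω) (V j ω), fun ω => h (V i ω) (V k ω); P]
      = ∫ s, kernelProj ν h s ^ 2 ∂ν := by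
  have hp := H.measurable_proj
  have hm : ∀ a b, Measurable fun ω => h (V a ω) (V b ω) := fun a b =>
    H.measurable.comp ((hVm a).prodMk (hVm b))
  have hL : ∀ a b, MemLp (fun ω => h (V a ω) (V b ω)) 2 P := fun a b =>
    MemLp.of_bound (hm a b).aestronglyMeasurable C (ae_of_all _ fun ω => H.bound _ _)
  have hLp : MemLp (fun ω => kernelProj ν h (V i ω)) 2 P :=
    MemLp.of_bound (hp.comp (hVm i)).aestronglyMeasurable C (ae_of_all _ fun ω => H.bound_proj _)
  have hmean : ∫ ω, h (V i ω) (V j ω) ∂P = 0 := by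
    have h1 := H.integral_sub_proj_mul hV hVm hVν hij hjk (φ := fun _ _ => 1) (D := 1)
      measurable_const (by simp)
    simp only [mul_one] at h1
    rw [integral_sub ((hL i j).integrable (by simp)) (hLp.integrable (by simp)),
      ← integral_map (f := kernelProj ν h) (hVm i).aemeasurable hp.aestronglyMeasurable, hVν,
      H.mean, sub_zero] at h1
    exact h1
  -- Both kernel terms are replaced by their projections, one after the other: the first uses that
  -- `j` is fresh, the second that `k` is.
  have h2 := H.integral_sub_proj_mul hV hVm hVν hij hjk (φ := h) H.measurable H.bound
  have h3 := H.integral_sub_proj_mul hV hVm hVν hik hjk.symm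
    (φ := fun s _ => kernelProj ν h s) (D := C) (hp.comp measurable_fst) fun s _ => H.bound_proj s
  simp only [sub_mul] at h2 h3
  have e2 := integral_sub ((hL i j).integrable_mul (hL i k)) (hLp.integrable_mul (hL i k))
  have e3 := integral_sub ((hL i k).integrable_mul hLp) (hLp.integrable_mul hLp)
  simp only [Pi.mul_apply] at e2 e3
  rw [e2] at h2
  rw [e3] at h3
  rw [covariance_eq_sub (hL i j) (hL i k), hmean, zero_mul, sub_zero, ← hVν i,
    integral_map (hVm i).aemeasurable (hVν i ▸ hp.pow_const 2).aestronglyMeasurable, hVν i]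
  simp only [Pi.mul_apply, sq]
  simp only [mul_comm (h (V i _) (V k _)) (kernelProj ν h (V i _))] at h3
  linarith

end IsCenteredKernel

/-! ### Central limit theorem for U-statistics of order two -/

namespace IsCenteredKernel

variable {ν : Measure ℝ} [IsProbabilityMeasure ν] {h : ℝ → ℝ → ℝ} {C : ℝ}
  {Ω : Type*} [MeasurableSpace Ω] {P : Measure Ω} [IsProbabilityMeasure P] {V : ℕ → Ω → ℝ}

omit [IsProbabilityMeasure ν] [MeasurableSpace Ω] in
/-- The Hoeffding decomposition of the sum of a kernel over the pairs of distinct indices. -/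
lemma sum_offDiag_eq (ν : Measure ℝ) (h : ℝ → ℝ → ℝ) (v : ℕ → ℝ) (n : ℕ) :
    ∑ p ∈ (Finset.range n).offDiag, h (v p.1) (v p.2)
      = 2 * ((n : ℝ) - 1) * ∑ j ∈ Finset.range n, kernelProj ν h (v j)
        + ∑ p ∈ (Finset.range n).offDiag, kernelDegen ν h (v p.1) (v p.2) := by
  have hs : ∀ f : ℕ × ℕ → ℝ, ∑ p ∈ (Finset.range n).offDiag, f p
      = ∑ j ∈ Finset.range n, ∑ k ∈ Finset.range n, f (j, k) - ∑ j ∈ Finset.range n, f (j, j) := by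
    intro f
    rw [← Finset.sum_product', ← Finset.diag_union_offDiag,
      Finset.sum_union (Finset.disjoint_diag_offDiag _), Finset.sum_diag]
    ring
  have hd : ∀ p : ℕ × ℕ, h (v p.1) (v p.2) = kernelProj ν h (v p.1) + kernelProj ν h (v p.2)
      + kernelDegen ν h (v p.1) (v p.2) := by
    intro p
    rw [kernelDegen]
    ring
  -- Each index is the first entry of `n - 1` ordered pairs and the second entry of as many, whence
  -- the factor `2 * (n - 1)`.
  rw [Finset.sum_congr rfl fun p _ => hd p, Finset.sum_add_distrib,
    hs fun p => kernelProj ν h (v p.1) + kernelProj ν h (v p.2)]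
  simp only [Finset.sum_add_distrib, Finset.sum_const, Finset.card_range, nsmul_eq_mul,
    ← Finset.mul_sum]
  ring

/-- The degenerate part of a `U`-statistic vanishes in probability, at the scale `√n`. -/
lemma tendstoInMeasure_degen (H : IsCenteredKernel ν h C) (hV : iIndepFun V P)
    (hVm : ∀ i, Measurable (V i)) (hVν : ∀ i, P.map (V i) = ν) :
    TendstoInMeasure P (fun (n : ℕ) ω => √(n : ℝ) * (((n : ℝ) * ((n : ℝ) - 1))⁻¹ *
      ∑ p ∈ (Finset.range n).offDiag, kernelDegen ν h (V p.1 ω) (V p.2 ω))) atTop 0 := by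
  rw [tendstoInMeasure_iff_measureReal_norm]
  intro ε hε
  set S : ℕ → Ω → ℝ := fun n ω =>
    ∑ p ∈ (Finset.range n).offDiag, kernelDegen ν h (V p.1 ω) (V p.2 ω)
  have hSm : ∀ n, Measurable (S n) := fun n =>
    Finset.measurable_sum _ fun p _ => H.measurable_degen_comp hVm _ _
  have hSb : ∀ n ω, |S n ω| ≤ (Finset.range n).offDiag.card * (3 * C) := fun n ω => by
    rw [← nsmul_eq_mul]
    exact (Finset.abs_sum_le_sum_abs _ _).trans
      (Finset.sum_le_card_nsmul _ _ _ fun p _ => H.bound_degen _ _)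
  -- Markov's inequality for the square: the scale contributes `n / (n * (n - 1)) ^ 2` and the
  -- second moment at most a constant times `n * (n - 1)`, leaving `O(1 / (n - 1))`.
  have key : ∀ n : ℕ, n ≥ 2 → P.real {ω | ε ≤ ‖√(n : ℝ) * (((n : ℝ) * ((n : ℝ) - 1))⁻¹ * S n ω)
      - (0 : Ω → ℝ) ω‖} ≤ (2 * (3 * C) ^ 2 / ε ^ 2) * ((n : ℝ) - 1)⁻¹ := by
    intro n hn
    have hn' : (2 : ℝ) ≤ n := by exact_mod_cast hn
    set a : ℝ := √(n : ℝ) * ((n : ℝ) * ((n : ℝ) - 1))⁻¹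
    have ha : a ^ 2 = (n : ℝ) * (((n : ℝ) * ((n : ℝ) - 1))⁻¹) ^ 2 := by
      rw [mul_pow, Real.sq_sqrt (by positivity)]
    have hset : {ω | ε ≤ ‖√(n : ℝ) * (((n : ℝ) * ((n : ℝ) - 1))⁻¹ * S n ω) - (0 : Ω → ℝ) ω‖}
        = {ω | ε ^ 2 ≤ a ^ 2 * S n ω ^ 2} := by
      ext ω
      simp only [Pi.zero_apply, sub_zero, Set.mem_ofPred_eq, Real.norm_eq_abs, ← mul_assoc]
      rw [← mul_pow, sq_le_sq, abs_of_pos hε]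
    have hint : Integrable (fun ω => a ^ 2 * S n ω ^ 2) P := by
      refine (Integrable.of_bound ((hSm n).pow_const 2).aestronglyMeasurable
        (((Finset.range n).offDiag.card * (3 * C)) ^ 2) (ae_of_all _ fun ω => ?_)).const_mul _
      rw [Real.norm_eq_abs, abs_pow]
      exact pow_le_pow_left₀ (abs_nonneg _) (hSb n ω) 2
    have h1 := mul_meas_ge_le_integral_of_nonneg
      (ae_of_all P fun ω => by positivity) hint (ε ^ 2)
    rw [integral_const_mul] at h1
    have h2 := H.integral_sq_sum_degen_le hV hVm hVν (Finset.range n)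
    rw [hset]
    have hcard : ((Finset.range n).offDiag.card : ℝ) = n * (n - 1) := by
      rw [Finset.offDiag_card, Finset.card_range, Nat.cast_sub (Nat.le_mul_self n)]
      push_cast
      ring
    rw [hcard] at h2
    have h3 : ε ^ 2 * P.real {ω | ε ^ 2 ≤ a ^ 2 * S n ω ^ 2}
        ≤ a ^ 2 * (n * (n - 1) * (2 * (3 * C) ^ 2)) :=
      h1.trans (mul_le_mul_of_nonneg_left h2 (sq_nonneg a))
    rw [ha] at h3
    have hn0 : (n : ℝ) ≠ 0 := by positivity
    have hn1 : (n : ℝ) - 1 ≠ 0 := by linarith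
    have h4 : (n : ℝ) * (((n : ℝ) * ((n : ℝ) - 1))⁻¹) ^ 2 * (n * (n - 1) * (2 * (3 * C) ^ 2))
        = ε ^ 2 * ((2 * (3 * C) ^ 2 / ε ^ 2) * ((n : ℝ) - 1)⁻¹) := by
      field_simp
    rw [h4] at h3
    rw [ha]
    exact le_of_mul_le_mul_left h3 (pow_pos hε 2)
  have hlim : Tendsto (fun n : ℕ => (2 * (3 * C) ^ 2 / ε ^ 2) * ((n : ℝ) - 1)⁻¹) atTop (𝓝 0) := by
    have := (tendsto_inv_atTop_zero (𝕜 := ℝ)).comp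
      (tendsto_atTop_add_const_right _ (-1) (tendsto_natCast_atTop_atTop (R := ℝ)))
    simpa [sub_eq_add_neg] using this.const_mul (2 * (3 * C) ^ 2 / ε ^ 2)
  exact squeeze_zero' (Eventually.of_forall fun n => measureReal_nonneg)
    (eventually_atTop.2 ⟨2, key⟩) hlim

/-- Hoeffding's central limit theorem for `U`-statistics of order two with a bounded kernel. -/
theorem tendstoInDistribution_uStat (H : IsCenteredKernel ν h C) (hV : iIndepFun V P)
    (hVm : ∀ i, Measurable (V i)) (hVν : ∀ i, P.map (V i) = ν) :
    TendstoInDistribution (fun (n : ℕ) ω => √(n : ℝ) * (((n : ℝ) * ((n : ℝ) - 1))⁻¹ *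
      ∑ p ∈ (Finset.range n).offDiag, h (V p.1 ω) (V p.2 ω))) atTop (id : ℝ → ℝ) (fun _ => P)
      (gaussianReal 0 (4 * ∫ s, kernelProj ν h s ^ 2 ∂ν).toNNReal) := by
  have hp := H.measurable_proj
  have hgm : Measurable fun s => 2 * kernelProj ν h s := hp.const_mul 2
  have hmean : ∫ ω, 2 * kernelProj ν h (V 0 ω) ∂P = 0 := by
    rw [integral_const_mul, ← integral_map (f := kernelProj ν h) (hVm 0).aemeasurable
      hp.aestronglyMeasurable, hVν, H.mean, mul_zero]
  have hvar : Var[fun ω => 2 * kernelProj ν h (V 0 ω); P] = 4 * ∫ s, kernelProj ν h s ^ 2 ∂ν := by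
    rw [variance_eq_integral (hgm.fun_comp (hVm 0)).aemeasurable, hmean, ← integral_const_mul,
      ← hVν 0, integral_map (hVm 0).aemeasurable
      (hVν 0 ▸ (hp.pow_const 2).const_mul 4).aestronglyMeasurable, hVν 0]
    congr with ω
    ring
  have hclt := tendstoInDistribution_inv_sqrt_mul_sum_sub (P := P) (Y := (id : ℝ → ℝ))
    (X := fun j ω => 2 * kernelProj ν h (V j ω))
    (P' := gaussianReal 0 (4 * ∫ s, kernelProj ν h s ^ 2 ∂ν).toNNReal)
    (by rw [hvar]; exact HasLaw.id)
    (MemLp.of_bound (hgm.comp (hVm 0)).aestronglyMeasurable (2 * C) (ae_of_all _ fun ω => by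
      simpa using H.bound_proj (V 0 ω)))
    (hV.comp (fun _ s => 2 * kernelProj ν h s) fun _ => hgm)
    (fun i => (IdentDistrib.mk (hVm i).aemeasurable (hVm 0).aemeasurable
      ((hVν i).trans (hVν 0).symm)).comp hgm)
  -- Slutsky's argument: for `n ≥ 2` the difference from the normalized sum of projections is
  -- exactly the degenerate part.
  refine tendstoInDistribution_of_tendstoInMeasure_sub _ _ hclt ?_ ?_
  · refine (H.tendstoInMeasure_degen hV hVm hVν).congr' ?_ ae_eq_rfl
    filter_upwards [eventually_ge_atTop 2] with n hn
    refine ae_of_all _ fun ω => ?_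
    have hn' : (2 : ℝ) ≤ n := by exact_mod_cast hn
    have hn1 : (n : ℝ) - 1 ≠ 0 := by linarith
    have hs : √(n : ℝ) ≠ 0 := (Real.sqrt_pos.2 (by linarith)).ne'
    have hss : (n : ℝ) = √(n : ℝ) * √(n : ℝ) := (Real.mul_self_sqrt (by linarith)).symm
    simp only [Pi.sub_apply, hmean, mul_zero, sub_zero, ← Finset.mul_sum]
    rw [sum_offDiag_eq ν h (fun j => V j ω) n]
    have h2 : √(n : ℝ) * (((n : ℝ) * ((n : ℝ) - 1))⁻¹ * (2 * ((n : ℝ) - 1))) = (√(n : ℝ))⁻¹ * 2 := by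
      have : ((n : ℝ) * ((n : ℝ) - 1))⁻¹ * (2 * ((n : ℝ) - 1)) = 2 * (n : ℝ)⁻¹ := by
        field_simp
      rw [this]
      nth_rw 2 [hss]
      field_simp
    linear_combination (-∑ j ∈ Finset.range n, kernelProj ν h (V j ω)) * h2
  · intro n
    exact ((Finset.measurable_sum _ fun p _ => measurable_comp_uncurry H.measurable
      (hVm p.1) (hVm p.2)).const_mul _).const_mul _ |>.aemeasurable

end IsCenteredKernel

/-! ### The arc kernel on the unit interval and its moments -/

/-- The uniform distribution on the unit interval. -/
noncomputable def unitLaw : Measure ℝ := volume.restrict (Set.Ioo 0 1)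

instance : IsProbabilityMeasure unitLaw := ⟨by simp [unitLaw]⟩

lemma unitLaw_real_apply {s : Set ℝ} (hs : MeasurableSet s) :
    unitLaw.real s = volume.real (s ∩ Set.Ioo 0 1) := by
  rw [unitLaw, measureReal_restrict_apply hs]

/-- Half the number of arcs between two points of an end interval, centered, in terms of their
distances to the finite end point divided by the length of the interval. -/
noncomputable def arcKernel (s t : ℝ) : ℝ :=
  ((if t < 2 * s then 1 else 0) + (if s < 2 * t then 1 else 0)) / 2 - 3 / 4

lemma measurable_arcKernel : Measurable (Function.uncurry arcKernel) := by
  have h1 : MeasurableSet {z : ℝ × ℝ | z.2 < 2 * z.1} :=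
    measurableSet_lt measurable_snd (measurable_fst.const_mul 2)
  have h2 : MeasurableSet {z : ℝ × ℝ | z.1 < 2 * z.2} :=
    measurableSet_lt measurable_fst (measurable_snd.const_mul 2)
  exact (((measurable_const.ite h1 measurable_const).add
    (measurable_const.ite h2 measurable_const)).div_const 2).sub_const _

lemma arcKernel_symm (s t : ℝ) : arcKernel s t = arcKernel t s := by
  rw [arcKernel, arcKernel, add_comm]

lemma abs_arcKernel_le (s t : ℝ) : |arcKernel s t| ≤ 1 := by
  rw [arcKernel]
  split_ifs <;> norm_num [abs_le]

lemma integral_ite_lt_two_mul {s : ℝ} (hs : s ∈ Set.Ioo (0 : ℝ) 1) :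
    ∫ t, (if t < 2 * s then (1 : ℝ) else 0) ∂unitLaw = min (2 * s) 1 := by
  have h := integral_indicator_one (μ := unitLaw) (measurableSet_Iio (a := 2 * s))
  rw [unitLaw_real_apply measurableSet_Iio] at h
  have h2 : Set.Iio (2 * s) ∩ Set.Ioo 0 1 = Set.Ioo 0 (min (2 * s) 1) := by
    ext t
    simp only [Set.mem_inter_iff, Set.mem_Iio, Set.mem_Ioo, lt_min_iff]
    tauto
  rw [h2, Real.volume_real_Ioo_of_le (le_min (by linarith [hs.1]) zero_le_one), sub_zero] at h
  rw [← h]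
  congr with t

lemma integral_ite_two_mul_gt {s : ℝ} (hs : s ∈ Set.Ioo (0 : ℝ) 1) :
    ∫ t, (if s < 2 * t then (1 : ℝ) else 0) ∂unitLaw = 1 - s / 2 := by
  have h := integral_indicator_one (μ := unitLaw) (measurableSet_Ioi (a := s / 2))
  rw [unitLaw_real_apply measurableSet_Ioi] at h
  have h2 : Set.Ioi (s / 2) ∩ Set.Ioo 0 1 = Set.Ioo (s / 2) 1 := by
    ext t
    simp only [Set.mem_inter_iff, Set.mem_Ioi, Set.mem_Ioo]
    constructor
    · tauto
    · rintro ⟨h1, h2⟩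
      exact ⟨h1, by linarith [hs.1], h2⟩
  rw [h2, Real.volume_real_Ioo_of_le (by linarith [hs.2])] at h
  rw [← h]
  congr with t
  simp only [Set.indicator_apply, Set.mem_Ioi, Pi.one_apply]
  congr 1
  simp only [eq_iff_iff]
  constructor <;> intro _ <;> linarith

lemma kernelProj_arcKernel {s : ℝ} (hs : s ∈ Set.Ioo (0 : ℝ) 1) :
    kernelProj unitLaw arcKernel s = min (2 * s) 1 / 2 - s / 4 - 1 / 4 := by
  have hi1 : Integrable (fun t => if t < 2 * s then (1 : ℝ) else 0) unitLaw :=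
    Integrable.of_bound (measurable_const.ite (measurableSet_Iio (a := 2 * s))
      measurable_const).aestronglyMeasurable 1
      (ae_of_all _ fun t => by split_ifs <;> simp)
  have hi2 : Integrable (fun t => if s < 2 * t then (1 : ℝ) else 0) unitLaw :=
    Integrable.of_bound (measurable_const.ite (measurableSet_lt measurable_const
      (measurable_id.const_mul 2)) measurable_const).aestronglyMeasurable 1
      (ae_of_all _ fun t => by split_ifs <;> simp)
  simp only [kernelProj, arcKernel]
  have hi3 : Integrable (fun t => ((if t < 2 * s then (1 : ℝ) else 0)
      + (if s < 2 * t then (1 : ℝ) else 0)) / 2) unitLaw := (hi1.add hi2).div_const 2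
  rw [integral_sub hi3 (integrable_const _), integral_div,
    integral_add hi1 hi2, integral_ite_lt_two_mul hs, integral_ite_two_mul_gt hs]
  simp
  ring

lemma integral_quadratic (a b c x y : ℝ) : ∫ s in x..y, a * s ^ 2 + b * s + c
    = a * (y ^ 3 - x ^ 3) / 3 + b * (y ^ 2 - x ^ 2) / 2 + c * (y - x) := by
  have h1 : IntervalIntegrable (fun s : ℝ => a * s ^ 2) volume x y :=
    Continuous.intervalIntegrable (by fun_prop) _ _
  have h2 : IntervalIntegrable (fun s : ℝ => b * s) volume x y :=
    Continuous.intervalIntegrable (by fun_prop) _ _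
  rw [intervalIntegral.integral_add (h1.add h2) (by simp), intervalIntegral.integral_add h1 h2,
    intervalIntegral.integral_const_mul, intervalIntegral.integral_const_mul, integral_pow,
    integral_id, intervalIntegral.integral_const, smul_eq_mul]
  push_cast
  ring

/-- The integral over the unit interval of a function that is quadratic on each of its halves. -/
lemma integral_unitLaw_eq {f : ℝ → ℝ} (a₁ b₁ c₁ a₂ b₂ c₂ : ℝ)
    (hf₁ : ∀ s ∈ Set.Ioo (0 : ℝ) 1, s ≤ 1 / 2 → f s = a₁ * s ^ 2 + b₁ * s + c₁)
    (hf₂ : ∀ s ∈ Set.Ioo (0 : ℝ) 1, 1 / 2 < s → f s = a₂ * s ^ 2 + b₂ * s + c₂) :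
    ∫ s, f s ∂unitLaw = a₁ / 24 + b₁ / 8 + c₁ / 2 + (7 * a₂ / 24 + 3 * b₂ / 8 + c₂ / 2) := by
  have hc₁ : Continuous fun s : ℝ => a₁ * s ^ 2 + b₁ * s + c₁ := by fun_prop
  have hc₂ : Continuous fun s : ℝ => a₂ * s ^ 2 + b₂ * s + c₂ := by fun_prop
  have hu : Set.Ioo (0 : ℝ) 1 = Set.Ioc 0 (1 / 2) ∪ Set.Ioo (1 / 2) 1 :=
    (Set.Ioc_union_Ioo_eq_Ioo (by norm_num) (by norm_num)).symm
  have e1 : Set.EqOn f (fun s => a₁ * s ^ 2 + b₁ * s + c₁) (Set.Ioc 0 (1 / 2)) := fun s hs =>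
    hf₁ s ⟨hs.1, by linarith [hs.2]⟩ hs.2
  have e2 : Set.EqOn f (fun s => a₂ * s ^ 2 + b₂ * s + c₂) (Set.Ioo (1 / 2) 1) := fun s hs =>
    hf₂ s ⟨by linarith [hs.1], hs.2⟩ hs.1
  have i1 : IntegrableOn f (Set.Ioc 0 (1 / 2)) :=
    (hc₁.integrableOn_Ioc).congr_fun e1.symm measurableSet_Ioc
  have i2 : IntegrableOn f (Set.Ioo (1 / 2) 1) :=
    (hc₂.integrableOn_Ioc.mono_set Set.Ioo_subset_Ioc_self).congr_fun e2.symm measurableSet_Ioo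
  rw [unitLaw, hu, setIntegral_union (Set.disjoint_left.2 fun s hs hs' => hs.2.not_gt hs'.1)
    measurableSet_Ioo i1 i2, setIntegral_congr_fun measurableSet_Ioc e1,
    setIntegral_congr_fun measurableSet_Ioo e2, ← integral_Ioc_eq_integral_Ioo,
    ← intervalIntegral.integral_of_le (by norm_num), ← intervalIntegral.integral_of_le (by norm_num),
    integral_quadratic, integral_quadratic]
  ring

lemma integral_kernelProj_arcKernel : ∫ s, kernelProj unitLaw arcKernel s ∂unitLaw = 0 := by
  -- The projection is `(3 * s - 1) / 4` up to `s = 1 / 2` and `(1 - s) / 4` beyond.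
  rw [integral_unitLaw_eq 0 (3 / 4) (-1 / 4) 0 (-1 / 4) (1 / 4)]
  · norm_num
  · intro s hs h
    rw [kernelProj_arcKernel hs, min_eq_left (by linarith)]
    ring
  · intro s hs h
    rw [kernelProj_arcKernel hs, min_eq_right (by linarith)]
    ring

lemma integral_kernelProj_arcKernel_sq :
    ∫ s, kernelProj unitLaw arcKernel s ^ 2 ∂unitLaw = 1 / 96 := by
  -- Coefficients of `(3 * s - 1) ^ 2 / 16` and `(1 - s) ^ 2 / 16`.
  rw [integral_unitLaw_eq (9 / 16) (-3 / 8) (1 / 16) (1 / 16) (-1 / 8) (1 / 16)]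
  · norm_num
  · intro s hs h
    rw [kernelProj_arcKernel hs, min_eq_left (by linarith)]
    ring
  · intro s hs h
    rw [kernelProj_arcKernel hs, min_eq_right (by linarith)]
    ring

lemma isCenteredKernel_arcKernel : IsCenteredKernel unitLaw arcKernel 1 :=
  ⟨measurable_arcKernel, arcKernel_symm, abs_arcKernel_le, integral_kernelProj_arcKernel⟩

lemma integral_min_two_mul : ∫ s, min (2 * s) 1 ∂unitLaw = 3 / 4 := by
  rw [integral_unitLaw_eq 0 2 0 0 0 1]
  · norm_num
  · intro s hs h
    rw [min_eq_left (by linarith)]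
    ring
  · intro s hs h
    rw [min_eq_right (by linarith)]
    ring

/-- Given `S = s` the probability is `min (2 * s) 1`, whose mean over the unit interval is `3 / 4`.
-/
lemma measureReal_lt_two_mul {Ω : Type*} [MeasurableSpace Ω] {P : Measure Ω}
    [IsProbabilityMeasure P] {S T : Ω → ℝ} (hS : Measurable S) (hT : Measurable T)
    (hST : IndepFun S T P) (hSlaw : P.map S = unitLaw) (hTlaw : P.map T = unitLaw) :
    P.real {ω | T ω < 2 * S ω} = 3 / 4 := by
  have hm : MeasurableSet {z : ℝ × ℝ | z.2 < 2 * z.1} :=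
    measurableSet_lt measurable_snd (measurable_fst.const_mul 2)
  have h1 : P.real {ω | T ω < 2 * S ω} = (unitLaw.prod unitLaw).real {z | z.2 < 2 * z.1} := by
    have h2 := (indepFun_iff_map_prod_eq_prod_map_map hS.aemeasurable hT.aemeasurable).1 hST
    rw [hSlaw, hTlaw] at h2
    rw [← h2, map_measureReal_apply (hS.prodMk hT) hm]
    rfl
  rw [h1, ← integral_indicator_one hm, integral_prod, ← integral_min_two_mul]
  · refine integral_congr_ae ?_
    filter_upwards [ae_restrict_mem measurableSet_Ioo] with s hs
    rw [← integral_ite_lt_two_mul hs]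
    rfl
  · exact (integrable_const (1 : ℝ)).indicator hm

/-! ### End intervals in the normalized coordinate -/

lemma map_affine_volume {a : ℝ} (ha : a ≠ 0) (b : ℝ) :
    (volume : Measure ℝ).map (fun x => a * x + b) = ENNReal.ofReal |a⁻¹| • volume := by
  have h := Measure.map_map (μ := (volume : Measure ℝ)) (measurable_add_const b)
    (measurable_const_mul a)
  rw [Real.map_volume_mul_left ha, Measure.map_smul, map_add_right_eq_self] at h
  exact h.symm

/-- An affine coordinate that maps a subset of `(δ₁, δ₂)` to the unit interval maps the restriction
of the uniform distribution to a multiple of the uniform distribution. -/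
lemma restrict_map_affine_cond {δ₁ δ₂ a b : ℝ} (hδ : δ₁ < δ₂) (ha : a ≠ 0)
    (hsub : (fun x => a * x + b) ⁻¹' Set.Ioo 0 1 ⊆ Set.Ioo δ₁ δ₂) :
    ((volume[|Set.Ioo δ₁ δ₂]).map (fun x => a * x + b)).restrict (Set.Ioo 0 1)
      = ENNReal.ofReal (|a⁻¹| / (δ₂ - δ₁)) • unitLaw := by
  have hu : Measurable fun x : ℝ => a * x + b := by fun_prop
  rw [Measure.restrict_map hu measurableSet_Ioo, ProbabilityTheory.cond, Measure.restrict_smul,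
    Measure.restrict_restrict_of_subset hsub, Measure.map_smul,
    ← Measure.restrict_map hu measurableSet_Ioo, map_affine_volume ha, Measure.restrict_smul,
    smul_smul, Real.volume_Ioo, div_eq_inv_mul,
    ENNReal.ofReal_mul (inv_nonneg.2 (by linarith)), ENNReal.ofReal_inv_of_pos (by linarith)]
  rfl

section EndCells

variable {Y : Finset ℝ} {δ₁ δ₂ : ℝ}

lemma orderStat_one (hY : Y.Nonempty) : orderStat Y δ₁ δ₂ 1 = Y.min' hY := by
  have h : 1 - 1 < Y.card := by simpa using hY.card_pos
  rw [orderStat, if_neg one_ne_zero, dif_pos h]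
  exact Finset.orderEmbOfFin_zero rfl hY.card_pos

lemma orderStat_card (hY : Y.Nonempty) : orderStat Y δ₁ δ₂ Y.card = Y.max' hY := by
  have h : Y.card - 1 < Y.card := Nat.sub_lt hY.card_pos one_pos
  rw [orderStat, if_neg hY.card_pos.ne', dif_pos h]
  exact Finset.orderEmbOfFin_last rfl hY.card_pos

lemma cellInterval_one (hY : Y.Nonempty) :
    cellInterval Y δ₁ δ₂ 1 = Set.Ioo δ₁ (Y.min' hY) := by
  rw [cellInterval, orderStat_one hY]
  simp [orderStat]

lemma cellInterval_card_add_one (hY : Y.Nonempty) :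
    cellInterval Y δ₁ δ₂ (Y.card + 1) = Set.Ioo (Y.max' hY) δ₂ := by
  rw [cellInterval, Nat.add_sub_cancel, orderStat_card hY]
  simp [orderStat]

lemma proximityRegion_of_lt_min' (hY : Y.Nonempty) (τ c : ℝ) {x : ℝ} (hx : x < Y.min' hY) :
    proximityRegion Y τ c x = leftEndRegion (Y.min' hY) τ x := by
  have h : ∀ y ∈ Y, x < y := fun y hy => hx.trans_le (Y.min'_le y hy)
  have hf : Y.filter (fun y => x < y) = Y := Finset.filter_true_of_mem h
  have hl : ¬ (Y.filter (fun y => y < x)).Nonempty := by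
    rw [Finset.not_nonempty_iff_eq_empty, Finset.filter_eq_empty_iff]
    exact fun y hy => (h y hy).not_gt
  have hr : (Y.filter (fun y => x < y)).Nonempty := hf.symm ▸ hY
  rw [proximityRegion, if_neg fun hx' => (h x hx').false]
  simp only [hf, hY, dif_pos]
  rw [dif_neg]
  simpa using hl

lemma proximityRegion_of_max'_lt (hY : Y.Nonempty) (τ c : ℝ) {x : ℝ} (hx : Y.max' hY < x) :
    proximityRegion Y τ c x = rightEndRegion (Y.max' hY) τ x := by
  have h : ∀ y ∈ Y, y < x := fun y hy => (Y.le_max' y hy).trans_lt hx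
  have hf : Y.filter (fun y => y < x) = Y := Finset.filter_true_of_mem h
  have hr : ¬ (Y.filter (fun y => x < y)).Nonempty := by
    rw [Finset.not_nonempty_iff_eq_empty, Finset.filter_eq_empty_iff]
    exact fun y hy => (h y hy).not_gt
  rw [proximityRegion, if_neg fun hx' => (h x hx').false]
  simp only [hf, hY, dif_pos]
  rw [dif_neg]
  simpa using hr

/-- In the distance to the finite end point, divided by the length, an end interval is the unit
interval, and arcs at `τ = 1` go from `s` to the points below `2 s`. -/
lemma exists_endCoordinate (hδ : δ₁ < δ₂) (hYne : Y.Nonempty)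
    (hY : ∀ y ∈ Y, y ∈ Set.Ioo δ₁ δ₂) (c : ℝ) {i : ℕ} (hi : i = 1 ∨ i = Y.card + 1) :
    ∃ u : ℝ → ℝ, ∃ p ∈ Set.Ioo (0 : ℝ) 1, Measurable u ∧
      (∀ x, x ∈ cellInterval Y δ₁ δ₂ i ↔ u x ∈ Set.Ioo (0 : ℝ) 1) ∧
      (∀ x ∈ cellInterval Y δ₁ δ₂ i, ∀ z ∈ cellInterval Y δ₁ δ₂ i,
        z ∈ proximityRegion Y 1 c x ↔ u z < 2 * u x) ∧
      ((volume[|Set.Ioo δ₁ δ₂]).map u).restrict (Set.Ioo 0 1) = ENNReal.ofReal p • unitLaw := by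
  rcases hi with rfl | rfl
  · have hb := hY _ (Y.min'_mem hYne)
    rw [cellInterval_one hYne]
    set b := Y.min' hYne with hbdef
    have hl : 0 < b - δ₁ := by linarith [hb.1]
    have hu : ∀ x, -(b - δ₁)⁻¹ * x + b * (b - δ₁)⁻¹ = (b - x) / (b - δ₁) := fun x => by
      field_simp
      ring
    have hmem : ∀ x, x ∈ Set.Ioo δ₁ b ↔
        -(b - δ₁)⁻¹ * x + b * (b - δ₁)⁻¹ ∈ Set.Ioo (0 : ℝ) 1 := fun x => by
      rw [hu, Set.mem_Ioo, Set.mem_Ioo, div_lt_one hl, div_pos_iff_of_pos_right hl]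
      constructor <;> rintro ⟨h1, h2⟩ <;> constructor <;> linarith
    -- The slope is negative because the distance is measured down from `b`. The witness for `p` is
    -- the share `(b - δ₁) / (δ₂ - δ₁)` of the interval, below `1` since `b < δ₂`.
    refine ⟨fun x => -(b - δ₁)⁻¹ * x + b * (b - δ₁)⁻¹, |(-(b - δ₁)⁻¹)⁻¹| / (δ₂ - δ₁), ?_,
      by fun_prop, hmem, ?_, restrict_map_affine_cond hδ (neg_ne_zero.2 (inv_ne_zero hl.ne')) ?_⟩
    · rw [inv_neg, inv_inv, abs_neg, abs_of_pos hl]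
      exact ⟨div_pos hl (by linarith), (div_lt_one (by linarith)).2 (by linarith [hb.2])⟩
    · intro x hx z hz
      beta_reduce
      rw [proximityRegion_of_lt_min' hYne 1 c hx.2, ← hbdef, hu, hu, leftEndRegion,
        ← mul_div_assoc, div_lt_div_iff_of_pos_right hl]
      simp only [Set.mem_inter_iff, Set.mem_Ioo, Set.mem_Iio]
      -- At `τ = 1` the upper bound `x + (b - x)` is `b` itself, so the only condition left is `2 *
      -- x - b < z`, that is, `b - z < 2 * (b - x)`.
      constructor
      · rintro ⟨⟨h1, h2⟩, h3⟩
        linarith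
      · intro h
        exact ⟨⟨by linarith, by linarith [hz.2]⟩, hz.2⟩
    · intro x hx
      have := (hmem x).2 hx
      exact ⟨this.1, this.2.trans hb.2⟩
  · have ha := hY _ (Y.max'_mem hYne)
    rw [cellInterval_card_add_one hYne]
    set a := Y.max' hYne with hadef
    have hl : 0 < δ₂ - a := by linarith [ha.2]
    have hu : ∀ x, (δ₂ - a)⁻¹ * x + -a * (δ₂ - a)⁻¹ = (x - a) / (δ₂ - a) := fun x => by
      field_simp
      ring
    have hmem : ∀ x, x ∈ Set.Ioo a δ₂ ↔
        (δ₂ - a)⁻¹ * x + -a * (δ₂ - a)⁻¹ ∈ Set.Ioo (0 : ℝ) 1 := fun x => by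
      rw [hu, Set.mem_Ioo, Set.mem_Ioo, div_lt_one hl, div_pos_iff_of_pos_right hl]
      constructor <;> rintro ⟨h1, h2⟩ <;> constructor <;> linarith
    refine ⟨fun x => (δ₂ - a)⁻¹ * x + -a * (δ₂ - a)⁻¹, |((δ₂ - a)⁻¹)⁻¹| / (δ₂ - δ₁), ?_,
      by fun_prop, hmem, ?_, restrict_map_affine_cond hδ (inv_ne_zero hl.ne') ?_⟩
    · rw [inv_inv, abs_of_pos hl]
      exact ⟨div_pos hl (by linarith), (div_lt_one (by linarith)).2 (by linarith [ha.1])⟩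
    · intro x hx z hz
      beta_reduce
      rw [proximityRegion_of_max'_lt hYne 1 c hx.1, ← hadef, hu, hu, rightEndRegion,
        ← mul_div_assoc, div_lt_div_iff_of_pos_right hl]
      simp only [Set.mem_inter_iff, Set.mem_Ioo, Set.mem_Ioi]
      constructor
      · rintro ⟨⟨h1, h2⟩, h3⟩
        linarith
      · intro h
        exact ⟨⟨by linarith [hz.1], by linarith⟩, hz.1⟩
    · intro x hx
      have := (hmem x).2 hx
      exact ⟨ha.1.trans this.1, this.2⟩

end EndCells

/-! ### The sample points that fall in the unit interval -/

lemma pi_const_smul {ι : Type*} [Fintype ι] (r : ℝ≥0∞) (ν : Measure ℝ) [SigmaFinite ν]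
    [SigmaFinite (r • ν)] :
    Measure.pi (fun _ : ι => r • ν) = r ^ Fintype.card ι • Measure.pi fun _ : ι => ν := by
  refine Measure.pi_eq fun s _ => ?_
  simp [Measure.pi_pi, Finset.prod_mul_distrib]

open Classical in
/-- The indices of the first `n` points that fall in the unit interval. -/
noncomputable def unitIndices (n : ℕ) (x : ℕ → ℝ) : Finset (Fin n) :=
  Finset.univ.filter fun j => x j ∈ Set.Ioo (0 : ℝ) 1

lemma mem_unitIndices {n : ℕ} {x : ℕ → ℝ} {j : Fin n} :
    j ∈ unitIndices n x ↔ x j ∈ Set.Ioo (0 : ℝ) 1 := by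
  simp [unitIndices]

section Sampling

variable {Ω : Type*} [MeasurableSpace Ω] {P : Measure Ω} [IsProbabilityMeasure P]
  {U : ℕ → Ω → ℝ} {p : ℝ}

/-- Independent points that are uniform when restricted to the unit interval have the product
uniform law when all of them are restricted to it. -/
lemma restrict_map_pi_eq {ι : Type*} [Fintype ι] {W : ι → Ω → ℝ} (hW : iIndepFun W P)
    (hWm : ∀ j, Measurable (W j))
    (hWp : ∀ j, (P.map (W j)).restrict (Set.Ioo 0 1) = ENNReal.ofReal p • unitLaw) :
    (P.map fun ω j => W j ω).restrict (Set.univ.pi fun _ => Set.Ioo 0 1)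
      = ENNReal.ofReal p ^ Fintype.card ι • Measure.pi fun _ : ι => unitLaw := by
  have := fun j => Measure.isProbabilityMeasure_map (μ := P) (hWm j).aemeasurable
  have : SigmaFinite (ENNReal.ofReal p • unitLaw) := by
    have : IsFiniteMeasure (ENNReal.ofReal p • unitLaw) :=
      Measure.smul_finite _ ENNReal.ofReal_ne_top
    infer_instance
  rw [(iIndepFun_iff_map_fun_eq_pi_map fun j => (hWm j).aemeasurable).1 hW,
    Measure.restrict_pi_pi]
  simp only [hWp]
  exact pi_const_smul _ _

lemma measure_notMem_unit {V : Ω → ℝ} (hV : Measurable V) (hp0 : 0 ≤ p)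
    (hVp : (P.map V).restrict (Set.Ioo 0 1) = ENNReal.ofReal p • unitLaw) :
    P (V ⁻¹' (Set.Ioo 0 1)ᶜ) = ENNReal.ofReal (1 - p) := by
  have h1 : P (V ⁻¹' Set.Ioo 0 1) = ENNReal.ofReal p := by
    have := congrArg (fun μ => μ Set.univ) hVp
    simpa [Measure.map_apply hV measurableSet_Ioo] using this
  rw [Set.preimage_compl, prob_compl_eq_one_sub (hV measurableSet_Ioo), h1,
    ENNReal.ofReal_sub _ hp0, ENNReal.ofReal_one]

/-- The joint law of the set of points in the unit interval and of these points. -/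
lemma measure_unitIndices_eq (hU : iIndepFun U P) (hUm : ∀ j, Measurable (U j)) (hp0 : 0 ≤ p)
    (hUp : ∀ j, (P.map (U j)).restrict (Set.Ioo 0 1) = ENNReal.ofReal p • unitLaw)
    {n k : ℕ} {S : Finset (Fin n)} (hS : S.card = k) {B : Set (Fin k → ℝ)}
    (hB : MeasurableSet B) :
    P {ω | unitIndices n (fun j => U j ω) = S ∧ (fun a => U (S.orderEmbOfFin hS a) ω) ∈ B}
      = ENNReal.ofReal p ^ k * ENNReal.ofReal (1 - p) ^ (n - k) *
        Measure.pi (fun _ : Fin k => unitLaw) B := by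
  have hU' : iIndepFun (fun (j : Fin n) ω => U j ω) P := hU.precomp Fin.val_injective
  have hind := hU'.indepFun_finset S Sᶜ disjoint_compl_right fun j => hUm j
  -- The event factors: `B₁` constrains only the points indexed by `S` (all inside, with values in
  -- `B`), `B₂` only the others (all outside). Listing `S` in increasing order turns the former into
  -- a tuple indexed by `Fin k`.
  set B₁ : Set (S → ℝ) := {w | (fun a => w ⟨S.orderEmbOfFin hS a, S.orderEmbOfFin_mem hS a⟩) ∈
    B ∩ Set.univ.pi fun _ => Set.Ioo 0 1}
  set B₂ : Set ((Sᶜ : Finset (Fin n)) → ℝ) := Set.univ.pi fun _ => (Set.Ioo 0 1)ᶜ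
  have hB₁ : MeasurableSet B₁ := by
    have hm : Measurable fun (w : S → ℝ) (a : Fin k) =>
        w ⟨S.orderEmbOfFin hS a, S.orderEmbOfFin_mem hS a⟩ :=
      measurable_pi_lambda _ fun a => measurable_pi_apply _
    exact hm (hB.inter (MeasurableSet.univ_pi fun _ => measurableSet_Ioo))
  have hB₂ : MeasurableSet B₂ := MeasurableSet.univ_pi fun _ => measurableSet_Ioo.compl
  have hset : {ω | unitIndices n (fun j => U j ω) = S ∧
      (fun a => U (S.orderEmbOfFin hS a) ω) ∈ B}
      = (fun ω (j : S) => U j ω) ⁻¹' B₁ ∩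
        (fun ω (j : (Sᶜ : Finset (Fin n))) => U j ω) ⁻¹' B₂ := by
    ext ω
    simp only [B₁, B₂, Set.mem_inter_iff, Set.mem_preimage, Set.mem_ofPred_eq, Set.mem_univ_pi,
      Finset.ext_iff, mem_unitIndices, Set.mem_compl_iff, Subtype.forall, Finset.mem_compl]
    constructor
    · rintro ⟨h1, h2⟩
      exact ⟨⟨h2, fun a => (h1 _).2 (S.orderEmbOfFin_mem hS a)⟩, fun j hj h => hj ((h1 j).1 h)⟩
    · rintro ⟨⟨h1, h2⟩, h3⟩
      refine ⟨fun j => ⟨fun h => by_contra fun hj => h3 j hj h, fun hj => ?_⟩, h1⟩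
      have hr : j ∈ Set.range (S.orderEmbOfFin hS) := by simpa using hj
      obtain ⟨a, rfl⟩ := hr
      exact h2 a
  rw [hset, hind.measure_inter_preimage_eq_mul _ _ hB₁ hB₂]
  have h1 : P ((fun ω (j : S) => U j ω) ⁻¹' B₁)
      = ENNReal.ofReal p ^ k * Measure.pi (fun _ : Fin k => unitLaw) B := by
    have h := restrict_map_pi_eq (W := fun (a : Fin k) ω => U (S.orderEmbOfFin hS a) ω)
      (hU'.precomp (S.orderEmbOfFin hS).injective) (fun a => hUm _) (fun a => hUp _)
    have h' := congrArg (fun μ => μ B) h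
    simp only [Measure.smul_apply, Fintype.card_fin, smul_eq_mul] at h'
    rw [← h', Measure.restrict_apply hB, Measure.map_apply (by fun_prop)
      (hB.inter (MeasurableSet.univ_pi fun _ => measurableSet_Ioo))]
    rfl
  have h2 : P ((fun ω (j : (Sᶜ : Finset (Fin n))) => U j ω) ⁻¹' B₂)
      = ENNReal.ofReal (1 - p) ^ (n - k) := by
    have h := hU'.measure_inter_preimage_eq_mul Sᶜ (sets := fun _ => (Set.Ioo (0 : ℝ) 1)ᶜ)
      (fun _ _ => measurableSet_Ioo.compl)
    rw [Finset.prod_congr rfl fun (j : Fin n) _ =>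
        (measure_notMem_unit (hUm j) hp0 (hUp j) : _ = ENNReal.ofReal (1 - p)),
      Finset.prod_const, Finset.card_compl, hS, Fintype.card_fin] at h
    rw [← h]
    congr 1
    ext ω
    simp [B₂]
  rw [h1, h2]
  ring

/-- On the event that `k` points fall in the unit interval, `T` is the function `F` of them. -/
def IsStatOfUnitPoints (U : ℕ → Ω → ℝ) (n k : ℕ) (F : (Fin k → ℝ) → ℝ) (T : Ω → ℝ) : Prop :=
  ∀ ω (h : (unitIndices n fun j => U j ω).card = k),
    T ω = F fun a => U ((unitIndices n fun j => U j ω).orderEmbOfFin h a) ω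

variable {n k : ℕ} {F : (Fin k → ℝ) → ℝ} {T : Ω → ℝ} {B : Set ℝ}

omit [MeasurableSpace Ω] in
lemma setOf_unitIndices_eq_and (hT : IsStatOfUnitPoints U n k F T) {S : Finset (Fin n)}
    (hS : S.card = k) (B : Set ℝ) :
    {ω | (unitIndices n fun j => U j ω) = S ∧ T ω ∈ B}
      = {ω | unitIndices n (fun j => U j ω) = S ∧
        (fun a => U (S.orderEmbOfFin hS a) ω) ∈ F ⁻¹' B} := by
  ext ω
  refine and_congr_right fun h => ?_
  subst h
  rw [hT ω hS]
  rfl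

omit [MeasurableSpace Ω] in
lemma setOf_card_unitIndices_eq_and (U : ℕ → Ω → ℝ) (n k : ℕ) (T : Ω → ℝ) (B : Set ℝ) :
    {ω | (unitIndices n fun j => U j ω).card = k ∧ T ω ∈ B}
      = ⋃ S ∈ Finset.powersetCard k (Finset.univ : Finset (Fin n)),
        {ω | (unitIndices n fun j => U j ω) = S ∧ T ω ∈ B} := by
  ext ω
  simp

/-- No measurability of `T` is assumed: on the event that the index set is `S`, `T` is `F` of fixed
coordinates. -/
lemma measurableSet_unitIndices_eq_and (hUm : ∀ j, Measurable (U j)) (hF : Measurable F)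
    (hT : IsStatOfUnitPoints U n k F T) (hB : MeasurableSet B) {S : Finset (Fin n)}
    (hS : S.card = k) : MeasurableSet {ω | (unitIndices n fun j => U j ω) = S ∧ T ω ∈ B} := by
  rw [setOf_unitIndices_eq_and hT hS]
  have h1 : {ω | unitIndices n (fun j => U j ω) = S} =
      ⋂ j : Fin n, {ω | U j ω ∈ Set.Ioo (0 : ℝ) 1 ↔ j ∈ S} := by
    ext ω
    simp [Finset.ext_iff, mem_unitIndices]
  have h2 : MeasurableSet {ω | unitIndices n (fun j => U j ω) = S} := by
    rw [h1]
    refine MeasurableSet.iInter fun j => ?_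
    by_cases hj : j ∈ S
    · simp only [hj, iff_true]
      exact hUm j measurableSet_Ioo
    · simp only [hj, iff_false]
      exact (hUm j measurableSet_Ioo).compl
  have h3 : Measurable fun ω (a : Fin k) => U (S.orderEmbOfFin hS a) ω := by fun_prop
  exact h2.inter (h3 (hF hB))

lemma measurableSet_card_unitIndices_eq_and (hUm : ∀ j, Measurable (U j)) (hF : Measurable F)
    (hT : IsStatOfUnitPoints U n k F T) (hB : MeasurableSet B) :
    MeasurableSet {ω | (unitIndices n fun j => U j ω).card = k ∧ T ω ∈ B} := by
  rw [setOf_card_unitIndices_eq_and]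
  exact Finset.measurableSet_biUnion _ fun S hS =>
    measurableSet_unitIndices_eq_and hUm hF hT hB (Finset.mem_powersetCard.1 hS).2

/-- The joint law of the number of points in the unit interval and of a statistic that depends on
these points only. -/
lemma measure_card_unitIndices_eq_and (hU : iIndepFun U P) (hUm : ∀ j, Measurable (U j))
    (hp0 : 0 ≤ p) (hUp : ∀ j, (P.map (U j)).restrict (Set.Ioo 0 1) = ENNReal.ofReal p • unitLaw)
    (hF : Measurable F) (hT : IsStatOfUnitPoints U n k F T) (hB : MeasurableSet B) :
    P {ω | (unitIndices n fun j => U j ω).card = k ∧ T ω ∈ B}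
      = (n.choose k * (ENNReal.ofReal p ^ k * ENNReal.ofReal (1 - p) ^ (n - k))) *
        (Measure.pi (fun _ : Fin k => unitLaw)).map F B := by
  rw [setOf_card_unitIndices_eq_and, measure_biUnion_finset]
  -- The probability depends on `S` only through its cardinality, so the sum over the `k`-subsets
  -- produces the binomial coefficient.
  · rw [Finset.sum_congr rfl (g := fun _ => ENNReal.ofReal p ^ k *
        ENNReal.ofReal (1 - p) ^ (n - k) * (Measure.pi (fun _ : Fin k => unitLaw)).map F B)]
    · rw [Finset.sum_const, Finset.card_powersetCard, Finset.card_univ, Fintype.card_fin,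
        nsmul_eq_mul]
      ring
    · intro S hS
      have hS' := (Finset.mem_powersetCard.1 hS).2
      rw [setOf_unitIndices_eq_and hT hS', measure_unitIndices_eq hU hUm hp0 hUp hS' (hF hB),
        Measure.map_apply hF hB]
  · intro S _ S' _ hSS'
    exact Set.disjoint_left.2 fun ω h h' => hSS' (h.1.symm.trans h'.1)
  · intro S hS
    exact measurableSet_unitIndices_eq_and hUm hF hT hB (Finset.mem_powersetCard.1 hS).2

/-- Conditionally on the event that all of finitely many points fall in the unit interval, they
are independent and uniform there. -/
lemma cond_forall_mem_unit {ι : Type*} [Fintype ι] {W : ι → Ω → ℝ} (hW : iIndepFun W P)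
    (hWm : ∀ j, Measurable (W j)) (hp : 0 < p)
    (hWp : ∀ j, (P.map (W j)).restrict (Set.Ioo 0 1) = ENNReal.ofReal p • unitLaw) :
    IsProbabilityMeasure (P[|{ω | ∀ j, W j ω ∈ Set.Ioo (0 : ℝ) 1}]) ∧
      iIndepFun W (P[|{ω | ∀ j, W j ω ∈ Set.Ioo (0 : ℝ) 1}]) ∧
      ∀ j, (P[|{ω | ∀ j, W j ω ∈ Set.Ioo (0 : ℝ) 1}]).map (W j) = unitLaw := by
  have hWm' : Measurable fun ω j => W j ω := by fun_prop
  have hR : MeasurableSet (Set.univ.pi fun _ : ι => Set.Ioo (0 : ℝ) 1) :=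
    MeasurableSet.univ_pi fun _ => measurableSet_Ioo
  have hA : {ω | ∀ j, W j ω ∈ Set.Ioo (0 : ℝ) 1}
      = (fun ω j => W j ω) ⁻¹' Set.univ.pi fun _ => Set.Ioo (0 : ℝ) 1 := by
    ext ω
    simp
  have hr := restrict_map_pi_eq hW hWm hWp
  have hP : P {ω | ∀ j, W j ω ∈ Set.Ioo (0 : ℝ) 1} = ENNReal.ofReal p ^ Fintype.card ι := by
    have := congrArg (fun μ => μ Set.univ) hr
    rw [hA, ← Measure.map_apply hWm' hR]
    simpa using this
  have h0 : ENNReal.ofReal p ^ Fintype.card ι ≠ 0 :=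
    pow_ne_zero _ (ENNReal.ofReal_pos.2 hp).ne'
  have ht : ENNReal.ofReal p ^ Fintype.card ι ≠ ∞ := ENNReal.pow_ne_top ENNReal.ofReal_ne_top
  have hprob : IsProbabilityMeasure (P[|{ω | ∀ j, W j ω ∈ Set.Ioo (0 : ℝ) 1}]) :=
    cond_isProbabilityMeasure (hP ▸ h0)
  have hmap : (P[|{ω | ∀ j, W j ω ∈ Set.Ioo (0 : ℝ) 1}]).map (fun ω j => W j ω)
      = Measure.pi fun _ : ι => unitLaw := by
    rw [ProbabilityTheory.cond, hP, Measure.map_smul, hA, ← Measure.restrict_map hWm' hR, hr,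
      smul_smul, ENNReal.inv_mul_cancel h0 ht, one_smul]
  have hlaw : ∀ j, (P[|{ω | ∀ j, W j ω ∈ Set.Ioo (0 : ℝ) 1}]).map (W j) = unitLaw := by
    intro j
    have h := congrArg (Measure.map (Function.eval j)) hmap
    rw [Measure.map_map (measurable_pi_apply j) hWm',
      (measurePreserving_eval (fun _ : ι => unitLaw) j).map_eq] at h
    exact h
  refine ⟨hprob, ?_, hlaw⟩
  rw [iIndepFun_iff_map_fun_eq_pi_map fun j => (hWm j).aemeasurable, hmap]
  simp only [hlaw]

end Sampling

/-! ### The limit law for a fixed number of uniform points -/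

/-- The standardized relative density of the arcs among `k` points of the unit interval. -/
noncomputable def arcStat (k : ℕ) (w : Fin k → ℝ) : ℝ :=
  √(k : ℝ) * ((∑ q ∈ (Finset.univ : Finset (Fin k)).offDiag,
    if w q.2 < 2 * w q.1 then (1 : ℝ) else 0) / ((k : ℝ) * ((k : ℝ) - 1)) - 3 / 4)

lemma measurable_arcStat (k : ℕ) : Measurable (arcStat k) := by
  refine (((Finset.measurable_sum _ fun q _ => ?_).div_const _).sub_const _).const_mul _
  exact measurable_const.ite (measurableSet_lt (measurable_pi_apply _)
    ((measurable_pi_apply _).const_mul 2)) measurable_const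

lemma sum_offDiag_fin (n : ℕ) (f : ℕ × ℕ → ℝ) :
    ∑ q ∈ (Finset.univ : Finset (Fin n)).offDiag, f (q.1, q.2)
      = ∑ q ∈ (Finset.range n).offDiag, f q := by
  refine Finset.sum_bij (fun q _ => ((q.1 : ℕ), (q.2 : ℕ))) ?_ ?_ ?_ fun _ _ => rfl
  · intro q hq
    have := (Finset.mem_offDiag.1 hq).2.2
    simp [Finset.mem_offDiag, Fin.val_inj, this]
  · intro a _ b _ h
    simpa [Prod.ext_iff, Fin.val_inj] using h
  · intro q hq
    obtain ⟨h1, h2, h3⟩ := Finset.mem_offDiag.1 hq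
    exact ⟨(⟨q.1, Finset.mem_range.1 h1⟩, ⟨q.2, Finset.mem_range.1 h2⟩),
      by simpa [Finset.mem_offDiag] using h3, rfl⟩

/-- For at least two points the standardized relative density is a `U`-statistic. -/
lemma arcStat_eq {k : ℕ} (hk : 2 ≤ k) (v : ℕ → ℝ) :
    arcStat k (fun a => v a) = √(k : ℝ) * (((k : ℝ) * ((k : ℝ) - 1))⁻¹ *
      ∑ q ∈ (Finset.range k).offDiag, arcKernel (v q.1) (v q.2)) := by
  -- The bound is needed: for `k = 1` the left side is `-3 / 4`, because `0 / 0 = 0`, and the right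
  -- side is `0`.
  have hk' : (2 : ℝ) ≤ k := by exact_mod_cast hk
  have hk1 : (k : ℝ) - 1 ≠ 0 := by linarith
  have hk0 : (k : ℝ) ≠ 0 := by positivity
  have hcard : ((Finset.range k).offDiag.card : ℝ) = k * (k - 1) := by
    rw [Finset.offDiag_card, Finset.card_range, Nat.cast_sub (Nat.le_mul_self k)]
    push_cast
    ring
  have hswap : ∑ q ∈ (Finset.range k).offDiag, (if v q.1 < 2 * v q.2 then (1 : ℝ) else 0)
      = ∑ q ∈ (Finset.range k).offDiag, if v q.2 < 2 * v q.1 then (1 : ℝ) else 0 := by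
    refine Finset.sum_equiv (Equiv.prodComm ℕ ℕ) (fun q => ?_) fun q _ => rfl
    simp only [Finset.mem_offDiag, Equiv.prodComm_apply, Prod.fst_swap, Prod.snd_swap]
    tauto
  rw [arcStat, sum_offDiag_fin k fun q => if v q.2 < 2 * v q.1 then (1 : ℝ) else 0]
  simp only [arcKernel, Finset.sum_sub_distrib, ← Finset.sum_div, Finset.sum_add_distrib, hswap,
    Finset.sum_const, nsmul_eq_mul, hcard]
  field_simp
  ring

/-- The law of the standardized relative density of `k` uniform points. -/
noncomputable def arcLaw (k : ℕ) : Measure ℝ :=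
  (Measure.pi fun _ : Fin k => unitLaw).map (arcStat k)

instance (k : ℕ) : IsProbabilityMeasure (arcLaw k) :=
  Measure.isProbabilityMeasure_map (measurable_arcStat k).aemeasurable

/-- The coordinates of an infinite product realize all sample sizes on one space, where the theorem
on `U`-statistics applies; the variance is `4 * (1 / 96)`. The first `k` coordinates recover `arcLaw
k`. -/
lemma tendsto_arcLaw : Tendsto (β := ProbabilityMeasure ℝ)
    (fun k => ⟨arcLaw k, inferInstance⟩) atTop (𝓝 ⟨gaussianReal 0 (1 / 24), inferInstance⟩) := by
  set Q : Measure (ℕ → ℝ) := Measure.infinitePi fun _ => unitLaw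
  have hind : iIndepFun (fun (j : ℕ) (x : ℕ → ℝ) => x j) Q :=
    iIndepFun_infinitePi (P := fun _ : ℕ => unitLaw) (X := fun _ y => y) fun _ => measurable_id
  have hlaw : ∀ j : ℕ, Q.map (fun x => x j) = unitLaw := fun j =>
    Measure.infinitePi_map_eval (fun _ => unitLaw) j
  have h := isCenteredKernel_arcKernel.tendstoInDistribution_uStat hind
    (fun j => measurable_pi_apply j) hlaw
  have hv : (4 * ∫ s, kernelProj unitLaw arcKernel s ^ 2 ∂unitLaw).toNNReal = 1 / 24 := by
    rw [integral_kernelProj_arcKernel_sq, ← NNReal.coe_inj]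
    norm_num
  have ht := h.tendsto
  simp only [hv, Measure.map_id] at ht
  refine ht.congr' ?_
  filter_upwards [eventually_ge_atTop 2] with k hk
  refine Subtype.ext ?_
  have hk : (fun x : ℕ → ℝ => √(k : ℝ) * (((k : ℝ) * ((k : ℝ) - 1))⁻¹ *
      ∑ q ∈ (Finset.range k).offDiag, arcKernel (x q.1) (x q.2)))
      = arcStat k ∘ fun x (a : Fin k) => x a := by
    ext x
    exact (arcStat_eq hk x).symm
  have hm : Measurable fun (x : ℕ → ℝ) (a : Fin k) => x a := by fun_prop
  have hpi : Q.map (fun x (a : Fin k) => x a) = Measure.pi fun _ : Fin k => unitLaw := by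
    have h1 := hind.precomp (g := fun a : Fin k => (a : ℕ)) Fin.val_injective
    rw [iIndepFun_iff_map_fun_eq_pi_map fun j => (measurable_pi_apply _).aemeasurable] at h1
    simpa only [hlaw] using h1
  change Q.map _ = arcLaw k
  rw [hk, ← Measure.map_map (measurable_arcStat k) hm, hpi, arcLaw]

/-! ### From the digraph to the normalized points -/

section Geometry

variable {Y : Finset ℝ} {δ₁ δ₂ c : ℝ} {i : ℕ} {u : ℝ → ℝ}

lemma cellCount_eq (hmem : ∀ x, x ∈ cellInterval Y δ₁ δ₂ i ↔ u x ∈ Set.Ioo (0 : ℝ) 1)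
    (n : ℕ) (x : ℕ → ℝ) :
    cellCount Y δ₁ δ₂ i n x = (unitIndices n fun j => u (x j)).card := by
  rw [cellCount, ← Set.ncard_coe_finset]
  congr 1
  ext j
  simp only [Set.mem_ofPred_eq, Finset.mem_coe, mem_unitIndices, hmem]

/-- The increasing enumeration of the indices in the cell maps the pairs counted by `arcStat`
bijectively onto the arcs of the induced subdigraph. -/
lemma arcStat_unitIndices_eq
    (hmem : ∀ x, x ∈ cellInterval Y δ₁ δ₂ i ↔ u x ∈ Set.Ioo (0 : ℝ) 1)
    (harc : ∀ x ∈ cellInterval Y δ₁ δ₂ i, ∀ z ∈ cellInterval Y δ₁ δ₂ i,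
      z ∈ proximityRegion Y 1 c x ↔ u z < 2 * u x)
    {n k : ℕ} {x : ℕ → ℝ} (h : (unitIndices n fun j => u (x j)).card = k) :
    √(k : ℝ) * (cellRelDensity Y δ₁ δ₂ 1 c i n x - 3 / 4)
      = arcStat k fun a => u (x ((unitIndices n fun j => u (x j)).orderEmbOfFin h a)) := by
  set S := unitIndices n fun j => u (x j) with hSdef
  set e := S.orderEmbOfFin h
  have hcell : {j : Fin n | x j ∈ cellInterval Y δ₁ δ₂ i} = (S : Set (Fin n)) := by
    ext j
    simp only [Set.mem_ofPred_eq, Finset.mem_coe, hSdef, mem_unitIndices, hmem]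
  have hS : ∀ j : Fin n, j ∈ S → x j ∈ cellInterval Y δ₁ δ₂ i := fun j hj =>
    (hmem _).2 (mem_unitIndices.1 hj)
  have hset : {q : Fin n × Fin n | q.1 ∈ (S : Set (Fin n)) ∧ q.2 ∈ (S : Set (Fin n)) ∧
      (centralSimilarityPCD Y 1 c fun j : Fin n => x j).Adj q.1 q.2}
      = Prod.map e e '' (((Finset.univ : Finset (Fin k)).offDiag.filter fun q =>
        u (x (e q.2)) < 2 * u (x (e q.1)) : Finset (Fin k × Fin k)) : Set (Fin k × Fin k)) := by
    ext ⟨a, b⟩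
    simp only [Set.mem_ofPred_eq, Finset.mem_coe, Set.mem_image, Finset.mem_filter,
      Finset.mem_offDiag, Finset.mem_univ, true_and, Prod.exists, Prod.map_apply, Prod.mk.injEq,
      centralSimilarityPCD]
    constructor
    · rintro ⟨ha, hb, hab, hadj⟩
      have hra : a ∈ Set.range e := by simpa [e] using ha
      have hrb : b ∈ Set.range e := by simpa [e] using hb
      obtain ⟨a', rfl⟩ := hra
      obtain ⟨b', rfl⟩ := hrb
      exact ⟨a', b', ⟨fun h' => hab (by rw [h']), (harc _ (hS _ ha) _ (hS _ hb)).1 hadj⟩, rfl, rfl⟩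
    · rintro ⟨a', b', ⟨hab, hadj⟩, rfl, rfl⟩
      have ha := S.orderEmbOfFin_mem h a'
      have hb := S.orderEmbOfFin_mem h b'
      exact ⟨ha, hb, fun h' => hab (e.injective h'), (harc _ (hS _ ha) _ (hS _ hb)).2 hadj⟩
  rw [cellRelDensity, inducedRelDensity, hcell, hset, Set.ncard_image_of_injective _
    (e.injective.prodMap e.injective), Set.ncard_coe_finset, Set.ncard_coe_finset, h, arcStat,
    Finset.card_filter]
  push_cast
  rfl

lemma halfArcs_eq (hmem : ∀ x, x ∈ cellInterval Y δ₁ δ₂ i ↔ u x ∈ Set.Ioo (0 : ℝ) 1)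
    (harc : ∀ x ∈ cellInterval Y δ₁ δ₂ i, ∀ z ∈ cellInterval Y δ₁ δ₂ i,
      z ∈ proximityRegion Y 1 c x ↔ u z < 2 * u x)
    {V : Type*} {x : V → ℝ} (hx : ∀ j, u (x j) ∈ Set.Ioo (0 : ℝ) 1) {j k : V} (hjk : j ≠ k) :
    halfArcs (centralSimilarityPCD Y 1 c x) j k = arcKernel (u (x j)) (u (x k)) + 3 / 4 := by
  have hx' := fun j => (hmem _).2 (hx j)
  simp only [halfArcs, centralSimilarityPCD, arcKernel, harc _ (hx' _) _ (hx' _), hjk, hjk.symm,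
    ne_eq, not_false_eq_true, true_and, sub_add_cancel]

end Geometry

/-! ### Conditioning on, and mixing over, the random number of points -/

/-- Averages of a convergent sequence, with weights that move off to infinity. -/
lemma tendsto_sum_weights_mul {w : ℕ → ℕ → ℝ} (hw0 : ∀ n k, 0 ≤ w n k)
    (hw1 : ∀ n, ∑ k ∈ Finset.range (n + 1), w n k = 1)
    (hw : ∀ k, Tendsto (fun n => w n k) atTop (𝓝 0)) {a : ℕ → ℝ} {l : ℝ}
    (ha : Tendsto a atTop (𝓝 l)) :
    Tendsto (fun n => ∑ k ∈ Finset.range (n + 1), w n k * a k) atTop (𝓝 l) := by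
  rw [Metric.tendsto_atTop]
  intro ε hε
  obtain ⟨K, hK⟩ := Metric.tendsto_atTop.1 ha (ε / 2) (half_pos hε)
  have h0 : Tendsto (fun n => ∑ k ∈ Finset.range K, w n k * |a k - l|) atTop (𝓝 0) := by
    have := tendsto_finsetSum (Finset.range K) fun k _ => (hw k).mul_const |a k - l|
    simpa using this
  obtain ⟨N, hN⟩ := Metric.tendsto_atTop.1 h0 (ε / 2) (half_pos hε)
  refine ⟨N, fun n hn => ?_⟩
  have hNn := hN n hn
  rw [Real.dist_eq, sub_zero] at hNn
  have hd : ∑ k ∈ Finset.range (n + 1), w n k * a k - l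
      = ∑ k ∈ Finset.range (n + 1), w n k * (a k - l) := by
    simp only [mul_sub, Finset.sum_sub_distrib, ← Finset.sum_mul, hw1, one_mul]
  rw [Real.dist_eq, hd]
  -- From `K` on the deviation is below `ε / 2` and the weights sum to one; the finitely many
  -- earlier terms vanish with their weights.
  have hterm : ∀ k, |w n k * (a k - l)|
      ≤ w n k * (ε / 2) + if k < K then w n k * |a k - l| else 0 := by
    intro k
    rw [abs_mul, abs_of_nonneg (hw0 n k)]
    split_ifs with hk
    · have := mul_nonneg (hw0 n k) (half_pos hε).le
      linarith
    · rw [add_zero]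
      exact mul_le_mul_of_nonneg_left (hK k (not_lt.1 hk)).le (hw0 n k)
  have hsub : ∑ k ∈ Finset.range (n + 1), (if k < K then w n k * |a k - l| else 0)
      ≤ ∑ k ∈ Finset.range K, w n k * |a k - l| := by
    rw [← Finset.sum_filter]
    refine Finset.sum_le_sum_of_subset_of_nonneg (fun k hk => ?_) fun k _ _ =>
      mul_nonneg (hw0 n k) (abs_nonneg _)
    exact Finset.mem_range.2 (Finset.mem_filter.1 hk).2
  calc |∑ k ∈ Finset.range (n + 1), w n k * (a k - l)|
      ≤ ∑ k ∈ Finset.range (n + 1), |w n k * (a k - l)| := Finset.abs_sum_le_sum_abs _ _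
    _ ≤ ∑ k ∈ Finset.range (n + 1),
          (w n k * (ε / 2) + if k < K then w n k * |a k - l| else 0) :=
        Finset.sum_le_sum fun k _ => hterm k
    _ ≤ ε / 2 + ∑ k ∈ Finset.range K, w n k * |a k - l| := by
        rw [Finset.sum_add_distrib, ← Finset.sum_mul, hw1, one_mul]
        linarith
    _ < ε := by linarith [le_abs_self (∑ k ∈ Finset.range K, w n k * |a k - l|)]

/-- For fixed `k` the coefficient is at most `n ^ k`, and the geometric factor `(1 - p) ^ n` wins
because `0 < p < 1`. -/
lemma tendsto_binomial_weight {p : ℝ} (hp : p ∈ Set.Ioo (0 : ℝ) 1) (k : ℕ) :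
    Tendsto (fun n : ℕ => (n.choose k : ℝ) * (p ^ k * (1 - p) ^ (n - k))) atTop (𝓝 0) := by
  have hq : 0 < 1 - p := by linarith [hp.2]
  have h := (tendsto_pow_const_mul_const_pow_of_abs_lt_one k (r := 1 - p)
    (by rw [abs_of_pos hq]; linarith [hp.1])).const_mul (p ^ k * ((1 - p) ^ k)⁻¹)
  rw [mul_zero] at h
  refine squeeze_zero' (Eventually.of_forall fun n => ?_) ?_ h
  · have := hp.1
    positivity
  · filter_upwards [eventually_ge_atTop k] with n hn
    have h1 : (n.choose k : ℝ) ≤ (n : ℝ) ^ k := by exact_mod_cast Nat.choose_le_pow n k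
    have h2 : (1 - p) ^ (n - k) = ((1 - p) ^ k)⁻¹ * (1 - p) ^ n := by
      rw [pow_sub₀ _ hq.ne' hn, mul_comm]
    rw [h2]
    calc (n.choose k : ℝ) * (p ^ k * (((1 - p) ^ k)⁻¹ * (1 - p) ^ n))
        ≤ (n : ℝ) ^ k * (p ^ k * (((1 - p) ^ k)⁻¹ * (1 - p) ^ n)) := by
          refine mul_le_mul_of_nonneg_right h1 ?_
          have := hp.1
          positivity
      _ = p ^ k * ((1 - p) ^ k)⁻¹ * ((n : ℝ) ^ k * (1 - p) ^ n) := by ring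

section Sampling

variable {Ω : Type*} [MeasurableSpace Ω] {P : Measure Ω} [IsProbabilityMeasure P]
  {U : ℕ → Ω → ℝ} {p : ℝ}

lemma toReal_binomial_weight (hp : p ∈ Set.Ioo (0 : ℝ) 1) (n k : ℕ) :
    ((n.choose k : ℝ≥0∞) * (ENNReal.ofReal p ^ k * ENNReal.ofReal (1 - p) ^ (n - k))).toReal
      = (n.choose k : ℝ) * (p ^ k * (1 - p) ^ (n - k)) := by
  simp [ENNReal.toReal_ofReal hp.1.le, ENNReal.toReal_ofReal (sub_nonneg.2 hp.2.le)]

/-- The conditional law, given the number of points in the unit interval. -/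
lemma cond_card_unitIndices (hU : iIndepFun U P) (hUm : ∀ j, Measurable (U j))
    (hp : p ∈ Set.Ioo (0 : ℝ) 1)
    (hUp : ∀ j, (P.map (U j)).restrict (Set.Ioo 0 1) = ENNReal.ofReal p • unitLaw)
    {n k : ℕ} (hkn : k ≤ n) {F : (Fin k → ℝ) → ℝ} (hF : Measurable F) {T : Ω → ℝ}
    (hT : IsStatOfUnitPoints U n k F T) {B : Set ℝ} (hB : MeasurableSet B) :
    (P[|{ω | (unitIndices n fun j => U j ω).card = k}]) {ω | T ω ∈ B}
      = (Measure.pi (fun _ : Fin k => unitLaw)).map F B := by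
  have := Measure.isProbabilityMeasure_map (μ := Measure.pi (fun _ : Fin k => unitLaw))
    hF.aemeasurable
  have huniv : {ω | (unitIndices n fun j => U j ω).card = k}
      = {ω | (unitIndices n fun j => U j ω).card = k ∧ T ω ∈ Set.univ} := by simp
  have hm := measurableSet_card_unitIndices_eq_and hUm hF hT MeasurableSet.univ
  -- The case `B = univ` gives the probability of the conditioning event; the binomial weight then
  -- cancels, being nonzero by `k ≤ n` and `0 < p < 1`.
  have h1 := measure_card_unitIndices_eq_and hU hUm hp.1.le hUp hF hT MeasurableSet.univ
  have h2 := measure_card_unitIndices_eq_and hU hUm hp.1.le hUp hF hT hB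
  rw [← huniv] at hm h1
  rw [measure_univ, mul_one] at h1
  rw [cond_apply hm, h1]
  have h3 : {ω | (unitIndices n fun j => U j ω).card = k} ∩ {ω | T ω ∈ B}
      = {ω | (unitIndices n fun j => U j ω).card = k ∧ T ω ∈ B} := rfl
  rw [h3, h2, ← mul_assoc, ENNReal.inv_mul_cancel, one_mul]
  · refine mul_ne_zero (by simpa using (Nat.choose_pos hkn).ne') (mul_ne_zero ?_ ?_)
    · exact pow_ne_zero _ (ENNReal.ofReal_pos.2 hp.1).ne'
    · exact pow_ne_zero _ (ENNReal.ofReal_pos.2 (by linarith [hp.2])).ne'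
  · exact ENNReal.mul_ne_top (by simp) (ENNReal.mul_ne_top
      (ENNReal.pow_ne_top ENNReal.ofReal_ne_top) (ENNReal.pow_ne_top ENNReal.ofReal_ne_top))

/-- A statistic of the points in the unit interval, whose laws given the number of these points
converge weakly, converges in distribution. -/
lemma tendstoInDistribution_of_card_unitIndices (hU : iIndepFun U P)
    (hUm : ∀ j, Measurable (U j)) (hp : p ∈ Set.Ioo (0 : ℝ) 1)
    (hUp : ∀ j, (P.map (U j)).restrict (Set.Ioo 0 1) = ENNReal.ofReal p • unitLaw)
    {F : ∀ k, (Fin k → ℝ) → ℝ} (hF : ∀ k, Measurable (F k)) {T : ℕ → Ω → ℝ}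
    (hT : ∀ n k, IsStatOfUnitPoints U n k (F k) (T n)) (κ : Measure ℝ) [IsProbabilityMeasure κ]
    (hlim : Tendsto (β := ProbabilityMeasure ℝ)
      (fun k => ⟨(Measure.pi (fun _ : Fin k => unitLaw)).map (F k),
        Measure.isProbabilityMeasure_map (hF k).aemeasurable⟩) atTop (𝓝 ⟨κ, inferInstance⟩)) :
    TendstoInDistribution T atTop (id : ℝ → ℝ) (fun _ => P) κ := by
  have hprob := fun k => Measure.isProbabilityMeasure_map
    (μ := Measure.pi (fun _ : Fin k => unitLaw)) (hF k).aemeasurable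
  have hset : ∀ n (B : Set ℝ), T n ⁻¹' B = ⋃ k ∈ Finset.range (n + 1),
      {ω | (unitIndices n fun j => U j ω).card = k ∧ T n ω ∈ B} := by
    intro n B
    ext ω
    have : (unitIndices n fun j => U j ω).card < n + 1 := by
      simpa [Nat.lt_succ_iff] using Finset.card_le_univ (unitIndices n fun j => U j ω)
    simpa using fun _ => Nat.lt_succ_iff.1 this
  have hms : ∀ n k {B : Set ℝ}, MeasurableSet B →
      MeasurableSet {ω | (unitIndices n fun j => U j ω).card = k ∧ T n ω ∈ B} := fun n k B hB =>
    measurableSet_card_unitIndices_eq_and hUm (hF k) (hT n k) hB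
  have hTm : ∀ n, Measurable (T n) := fun n B hB => by
    rw [hset]
    exact Finset.measurableSet_biUnion _ fun k _ => hms n k hB
  set w : ℕ → ℕ → ℝ≥0∞ := fun n k =>
    (n.choose k : ℝ≥0∞) * (ENNReal.ofReal p ^ k * ENNReal.ofReal (1 - p) ^ (n - k)) with hwdef
  have hwt : ∀ n k, w n k ≠ ∞ := fun n k => ENNReal.mul_ne_top (by simp) (ENNReal.mul_ne_top
    (ENNReal.pow_ne_top ENNReal.ofReal_ne_top) (ENNReal.pow_ne_top ENNReal.ofReal_ne_top))
  have hmap : ∀ n, P.map (T n) = ∑ k ∈ Finset.range (n + 1),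
      w n k • (Measure.pi (fun _ : Fin k => unitLaw)).map (F k) := by
    intro n
    ext B hB
    rw [Measure.map_apply (hTm n) hB, hset, measure_biUnion_finset]
    · rw [Measure.finsetSum_apply]
      refine Finset.sum_congr rfl fun k _ => ?_
      rw [measure_card_unitIndices_eq_and hU hUm hp.1.le hUp (hF k) (hT n k) hB,
        Measure.smul_apply, smul_eq_mul]
    · intro k _ k' _ hkk'
      exact Set.disjoint_left.2 fun ω h h' => hkk' (h.1.symm.trans h'.1)
    · exact fun k _ => hms n k hB
  -- That the weights sum to one is read off from the total mass of the mixture.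
  have hw1 : ∀ n, ∑ k ∈ Finset.range (n + 1), (w n k).toReal = 1 := by
    intro n
    have := Measure.isProbabilityMeasure_map (μ := P) (hTm n).aemeasurable
    have h := congrArg (fun μ => (μ Set.univ).toReal) (hmap n)
    simp only [measure_univ, Measure.finsetSum_apply, Measure.smul_apply, smul_eq_mul, mul_one,
      ENNReal.toReal_one] at h
    rw [h, ENNReal.toReal_sum fun k _ => hwt n k]
  refine ⟨fun n => (hTm n).aemeasurable, aemeasurable_id, ?_⟩
  refine ProbabilityMeasure.tendsto_iff_forall_integral_tendsto.2 fun f => ?_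
  have h := tendsto_sum_weights_mul (w := fun n k => (w n k).toReal)
    (fun n k => ENNReal.toReal_nonneg) hw1
    (fun k => by simpa only [hwdef, toReal_binomial_weight hp] using tendsto_binomial_weight hp k)
    (ProbabilityMeasure.tendsto_iff_forall_integral_tendsto.1 hlim f)
  simp only [ProbabilityMeasure.coe_mk, Measure.map_id] at h ⊢
  refine h.congr fun n => ?_
  rw [hmap, integral_finsetSum_measure fun k _ => (f.integrable _).smul_measure (hwt n k)]
  simp only [integral_smul_measure, smul_eq_mul]

end Sampling

/-! ### Assembly -/

lemma covariance_congr_of_ae_eq {Ω : Type*} [MeasurableSpace Ω] {P : Measure Ω}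
    {f f' g g' : Ω → ℝ} (hf : f =ᵐ[P] f') (hg : g =ᵐ[P] g') : cov[f, g; P] = cov[f', g'; P] := by
  rw [covariance, covariance, integral_congr_ae hf, integral_congr_ae hg]
  refine integral_congr_ae ?_
  filter_upwards [hf, hg] with ω h1 h2
  rw [h1, h2]

/-- The portmanteau theorem applies because the frontier `{t}` is null: the limit has nonzero
variance, hence no atoms. -/
lemma tendsto_arcLaw_Iic (t : ℝ) :
    Tendsto (fun k => (arcLaw k).real (Set.Iic t)) atTop (𝓝 (cdf (gaussianReal 0 (1 / 24)) t)) := by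
  have : NullSingletonClass (gaussianReal 0 (1 / 24)) := nullSingletonClass_gaussianReal (by norm_num)
  have h := ProbabilityMeasure.tendsto_measure_of_null_frontier_of_tendsto' tendsto_arcLaw
    (E := Set.Iic t) (by rw [frontier_Iic]; exact measure_singleton (μ := gaussianReal 0 (1 / 24)) t)
  rw [cdf_eq_real]
  exact (ENNReal.tendsto_toReal (measure_ne_top _ _)).comp h

theorem mainTheorem8 {Ω : Type*} [MeasurableSpace Ω] (P : Measure Ω) [IsProbabilityMeasure P]
    (δ₁ δ₂ : ℝ) (hδ : δ₁ < δ₂)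
    (Y : Finset ℝ) (hYne : Y.Nonempty) (hY : ∀ y ∈ Y, y ∈ Set.Ioo δ₁ δ₂)
    (c : ℝ) (hc : c ∈ Set.Ioo (0 : ℝ) 1)
    (X : ℕ → Ω → ℝ) (hXm : ∀ j, Measurable (X j))
    (hXunif : ∀ j, pdf.IsUniform (X j) (Set.Ioo δ₁ δ₂) P volume)
    (hXindep : iIndepFun X P)
    (i : ℕ) (hi : i = 1 ∨ i = Y.card + 1) :
    -- the arc probability `μ_e(1)` in the end interval
    (P[|{ω | ∀ j : Fin 2, X j ω ∈ cellInterval Y δ₁ δ₂ i}]).real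
        {ω | (centralSimilarityPCD Y 1 c (fun j : Fin 2 => X j ω)).Adj 0 1} = 3 / 4 ∧
    -- `4 ν_e(1)`, where `ν_e(1)` is the covariance of `h_12` and `h_13` in the end interval
    4 * cov[fun ω => halfArcs (centralSimilarityPCD Y 1 c (fun j : Fin 3 => X j ω)) 0 1,
          fun ω => halfArcs (centralSimilarityPCD Y 1 c (fun j : Fin 3 => X j ω)) 0 2;
          P[|{ω | ∀ j : Fin 3, X j ω ∈ cellInterval Y δ₁ δ₂ i}]] = 1 / 24 ∧
    -- convergence in law given `n_i = k`, as `k → ∞`, uniformly in the sample size `n ≥ k`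
    (∀ t : ℝ, ∀ ε > (0 : ℝ), ∃ K : ℕ, ∀ k ≥ K, ∀ n ≥ k,
      |(P[|{ω | cellCount Y δ₁ δ₂ i n (fun j => X j ω) = k}]).real
          {ω | √(k : ℝ) * (cellRelDensity Y δ₁ δ₂ 1 c i n (fun j => X j ω) - 3 / 4) ≤ t}
        - cdf (gaussianReal 0 (1 / 24)) t| < ε) ∧
    -- convergence in law with the random `n_i`, as the sample size `n → ∞`
    TendstoInDistribution
      (fun (n : ℕ) (ω : Ω) => √(cellCount Y δ₁ δ₂ i n (fun j => X j ω) : ℝ) *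
        (cellRelDensity Y δ₁ δ₂ 1 c i n (fun j => X j ω) - 3 / 4))
      atTop (id : ℝ → ℝ) (fun _ => P) (gaussianReal 0 (1 / 24)) := by
  obtain ⟨u, p, hp, hu, hmem, harc, hlaw⟩ := exists_endCoordinate hδ hYne hY c hi
  set U : ℕ → Ω → ℝ := fun j ω => u (X j ω) with hUdef
  have hUm : ∀ j, Measurable (U j) := fun j => hu.comp (hXm j)
  have hU : iIndepFun U P := hXindep.comp (fun _ => u) fun _ => hu
  have hUp : ∀ j, (P.map (U j)).restrict (Set.Ioo 0 1) = ENNReal.ofReal p • unitLaw := fun j => by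
    rw [← hlaw, ← hXunif j, Measure.map_map hu (hXm j)]
    rfl
  have hcond := fun d : ℕ => cond_forall_mem_unit (P := P) (W := fun (j : Fin d) ω => U j ω)
    (hU.precomp Fin.val_injective) (fun j => hUm j) hp.1 fun j => hUp j
  have hA : ∀ d : ℕ, {ω | ∀ j : Fin d, X j ω ∈ cellInterval Y δ₁ δ₂ i}
      = {ω | ∀ j : Fin d, U j ω ∈ Set.Ioo (0 : ℝ) 1} := fun d => by
    ext ω
    exact forall_congr' fun j => hmem _
  have hAm : ∀ d : ℕ, MeasurableSet {ω | ∀ j : Fin d, U j ω ∈ Set.Ioo (0 : ℝ) 1} := fun d => by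
    rw [Set.ofPred_forall]
    exact MeasurableSet.iInter fun j => hUm j measurableSet_Ioo
  have hT : ∀ n k, IsStatOfUnitPoints U n k (arcStat k) fun ω => √(k : ℝ) *
      (cellRelDensity Y δ₁ δ₂ 1 c i n (fun j => X j ω) - 3 / 4) := fun n k ω h =>
    arcStat_unitIndices_eq hmem harc (x := fun j => X j ω) h
  refine ⟨?_, ?_, ?_, ?_⟩
  · obtain ⟨hprob, hind, hl⟩ := hcond 2
    rw [hA, ← measureReal_lt_two_mul (hUm 0) (hUm 1) (hind.indepFun zero_ne_one) (hl 0) (hl 1)]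
    refine measureReal_congr ?_
    filter_upwards [ae_cond_mem (hAm 2)] with ω hω
    have hω' := fun j => (hmem _).2 (hω j)
    exact propext ((and_iff_right zero_ne_one).trans (harc _ (hω' 0) _ (hω' 1)))
  · obtain ⟨hprob, hind, hl⟩ := hcond 3
    have hK := isCenteredKernel_arcKernel.covariance_eq hind (fun j => hUm j) hl
      (i := 0) (j := 1) (k := 2) (by decide) (by decide) (by decide)
    have hae : ∀ k : Fin 3, 0 ≠ k → (fun ω => halfArcs (centralSimilarityPCD Y 1 c
        (fun j : Fin 3 => X j ω)) 0 k) =ᵐ[P[|{ω | ∀ j : Fin 3, U j ω ∈ Set.Ioo (0 : ℝ) 1}]]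
        fun ω => arcKernel (U (0 : Fin 3) ω) (U k ω) + 3 / 4 := fun k hk => by
      filter_upwards [ae_cond_mem (hAm 3)] with ω hω
      exact halfArcs_eq hmem harc hω hk
    have hint : ∀ k : Fin 3, Integrable (fun ω => arcKernel (U (0 : Fin 3) ω) (U k ω))
        (P[|{ω | ∀ j : Fin 3, U j ω ∈ Set.Ioo (0 : ℝ) 1}]) := fun k =>
      Integrable.of_bound (measurable_comp_uncurry measurable_arcKernel (hUm _)
        (hUm _)).aestronglyMeasurable 1 (ae_of_all _ fun ω => abs_arcKernel_le _ _)
    rw [hA, covariance_congr_of_ae_eq (hae 1 (by decide)) (hae 2 (by decide)),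
      covariance_add_const_left (hint 1), covariance_add_const_right (hint 2), hK,
      integral_kernelProj_arcKernel_sq]
    norm_num
  · intro t ε hε
    obtain ⟨K, hK⟩ := Metric.tendsto_atTop.1 (tendsto_arcLaw_Iic t) ε hε
    refine ⟨K, fun k hk n hn => ?_⟩
    -- The conditional probability equals `arcLaw k` of `Set.Iic t`, which does not involve `n`; so
    -- one `K` serves every `n ≥ k`.
    have h := cond_card_unitIndices hU hUm hp hUp hn (measurable_arcStat k) (hT n k)
      (measurableSet_Iic (a := t))
    have hc : {ω | cellCount Y δ₁ δ₂ i n (fun j => X j ω) = k}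
        = {ω | (unitIndices n fun j => U j ω).card = k} := by
      ext ω
      simp only [Set.mem_ofPred_eq, cellCount_eq hmem, hUdef]
    rw [hc]
    have h' := congrArg ENNReal.toReal h
    have hKk := hK k hk
    rw [Real.dist_eq] at hKk
    exact (congrArg (fun a => |a - cdf (gaussianReal 0 (1 / 24)) t|) h').trans_lt hKk
  · refine tendstoInDistribution_of_card_unitIndices hU hUm hp hUp measurable_arcStat
      (fun n k ω h => ?_) _ tendsto_arcLaw
    -- On the event `n_i = k` the random factor `√n_i` is `√k`, so the statistic is again `arcStat
    -- k` of the points in the cell.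
    rw [← hT n k ω h, cellCount_eq hmem, ← h]
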